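/- For an integer $a\ge 1$ let ${}^{0}a=1$ and ${}^{b+1}a=a^{({}^{b}a)}$. For $a\ge 2$ with $10\nmid a$ and $b\ge 1$, the congruence speed $V(a,b)$ is the integer $v\ge 0$ (when there is one) such that, for some $d\ge 0$, ${}^{b-1}a\equiv{}^{b}a$ modulo $10^{d}$ but not modulo $10^{d+1}$, and ${}^{b}a\equiv{}^{b+1}a$ modulo $10^{d+v}$ but not modulo $10^{d+v+1}$. We write $V(a)=n$ if $V(a,b)=n$ for all $b>a$, and put $V(1)=0$. For $s\in\{1,\dots,9\}$ let $A_s(n)=\{a\ge 1: a\equiv s \pmod{10},\ V(a)=n\}$. Here $x \bmod m$ is the residue in $\{0,\dots,m-1\}$, and $j,k$ range over the integers $\ge 0$. Put $$\rho_1(n)=2^{4\cdot 5^n+1}-1,\quad \rho_2(n)=2^{5^n},\quad \rho_3(n)=5^{2^n}-2^{5^n},\quad \rho_3'(n)=-5^{2^n}-2^{5^n},$$ $$\rho_7(n)=2^{5^n}-5^{2^n},\quad \rho_7'(n)=5^{2^n}+2^{5^n},\quad \rho_8(n)=-2^{5^n},\quad \rho_9(n)=2\cdot 5^{2^n}-1.$$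 For a sequence $\rho$ of integers put $$\delta_\rho(n)=\frac{\rho(n+1) \bmod 10^{n+1}-\rho(n)\bmod 10^n}{10^n},\qquad R_\rho(n)=\{(\rho(n)\bmod 10^n)+j\cdot 10^n:\ j\not\equiv\delta_\rho(n) \pmod{10}\},$$ $$\tilde a_\rho(n)=\big((\rho(n)\bmod 10^n)\bmod 2\cdot 5^n\big)+\lambda_\rho(n)\cdot 2\cdot 5^n,$$ where $\lambda_\rho(n)=1$ if $(\rho(n)\bmod 10^n)\bmod 2\cdot5^n=(\rho(n+1)\bmod 10^{n+1})\bmod 2\cdot 5^{n+1}$, and $\lambda_\rho(n)=0$ otherwise. Then the following hold. (a) For every $a\ge1$ with $10\nmid a$, $V(a)$ exists and is unique. (b) For each $\rho$ of the eight sequences above and every $n\ge 0$, $\rho(n+1)\equiv\rho(n)$ and $\rho(n)^5\equiv\rho(n)$ modulo $10^n$; that is, the $\rho(n)\bmod 10^n$ are the residues of a $10$-adic integer $y$ with $y^5=y$. (c) For every $n\ge 2$: - $A_1(n)=R_{\rho_1}(n)\cup\{10^n+1+k\cdot 10^n: k\equiv 0,1,\dots,8 \pmod{10}\}$; - $A_9(n)=R_{\rho_9}(n)\cup\{10^n-1+k\cdot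 10^n: k\equiv 0,1,\dots,8 \pmod{10}\}$; - $A_5(n)$ is the set of all numbers $2^n\left(5+2\sin\frac{\pi n}{2}+4\cos\frac{\pi n}{2}\right)+1+k\cdot 5\cdot 2^{n+1}$ and $2^n\left(5-2\sin\frac{\pi n}{2}-4\cos\frac{\pi n}{2}\right)-1+k\cdot 5\cdot 2^{n+1}$, and $\min A_5(n)\le 9\cdot 2^n+1$; - $A_4(n)=\{5^n-1+k\cdot 2\cdot 5^n: k\equiv 0,1,3,4 \pmod 5\}$ and $A_6(n)=\{5^n+1+k\cdot 2\cdot 5^n: k\equiv 0,1,3,4 \pmod 5\}$; - $A_3(n)=R_{\rho_3}(n)\cup R_{\rho_3'}(n)$ and $A_7(n)=R_{\rho_7}(n)\cup R_{\rho_7'}(n)$; - for $s\in\{2,8\}$, $\min A_s(n)=\tilde a_{\rho_s}(n)$ and $$A_s(n)=\left\{\tilde a_{\rho_s}(n)+k\cdot 2\cdot 5^n:\ k\not\equiv\frac{\tilde a_{\rho_s}(n+1)-\tilde a_{\rho_s}(n)}{2\cdot 5^n} \pmod 5\right\}.$$ (d) Let $n\ge 1$, and let $v_p$ be the $p$-adic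 valuation. If $a\in A_1(n)\cup A_9(n)$, then $n\le\min(v_5(a^2-1),v_2(a^2-1))$. If $a\in A_3(n)\cup A_7(n)$, then $n\le\min(v_5(a^2+1),v_2(a^2-1))$. If $a\in A_2(n)\cup A_8(n)$, then with $N=v_5(a^2+1)$ and the integer $c=(a^2+1)/5^N$ one has $n\le N$, $a=\sqrt{5^N c-1}$ and $N=\ln\left(\frac{a^2+1}{c}\right)/\ln 5$. (e) $V(a)=1$ if and only if $a$ is congruent modulo $25$ to one of $2,3,4,6,8,9,11,12,13,14,16,17,19,21,22,23$. -/

import Mathlib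

/-- The power tower `a ^ (a ^ (⋯ ^ a))` of height `b` (with value `1` at height `0`). -/
def tetration (a : ℕ) : ℕ → ℕ
  | 0 => 1
  | b + 1 => a ^ tetration a b

/-- `d` is the exact number of stable trailing decimal digits at height `b`: the towers of heights
`b` and `b + 1` are congruent modulo `10 ^ d` but not modulo `10 ^ (d + 1)`. -/
def StableDigits (a b d : ℕ) : Prop :=
  tetration a b ≡ tetration a (b + 1) [MOD 10 ^ d] ∧
    ¬ tetration a b ≡ tetration a (b + 1) [MOD 10 ^ (d + 1)]

/-- `V(a, b) = v` for `b ≥ 1`: the number of stable digits grows by exactly `v` from height `b - 1`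
to height `b`. -/
def HasSpeedAt (a b v : ℕ) : Prop :=
  ∃ d, StableDigits a (b - 1) d ∧ StableDigits a b (d + v)

/-- `V(a) = n`: the base `a` is not a multiple of `10`, and its constant congruence speed is `n`,
i.e. `V(a, b) = n` at all heights `b > a`; by convention `V(1) = 0`. -/
def HasSpeed (a n : ℕ) : Prop :=
  ¬ 10 ∣ a ∧ ((a = 1 ∧ n = 0) ∨ (2 ≤ a ∧ ∀ b, a < b → HasSpeedAt a b n))

/-- The set `A_s(n)` of the bases with last digit `s` and constant congruence speed `n`. -/
def speedSet (s n : ℕ) : Set ℕ :=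
  {a | a ≡ s [MOD 10] ∧ HasSpeed a n}

/-- The digit of weight `10 ^ n` of the `10`-adic integer whose residue modulo `10 ^ m` is that of
`X m`, for every `m`. -/
def nextDigit (X : ℕ → ℤ) (n : ℕ) : ℤ :=
  (X (n + 1) % 10 ^ (n + 1) - X n % 10 ^ n) / 10 ^ n

/-- The numbers `(X n mod 10 ^ n) + j * 10 ^ n`, where `j ≥ 0` is not congruent modulo `10` to the
next digit. -/
def rootClass (X : ℕ → ℤ) (n : ℕ) : Set ℕ :=
  {a | ∃ j : ℕ, ¬ (j : ℤ) ≡ nextDigit X n [ZMOD 10] ∧ (a : ℤ) = X n % 10 ^ n + j * 10 ^ n}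

/-- `λ(n)`: it is `1` if the residues of the truncations `X n mod 10 ^ n` modulo `2 * 5 ^ n` and
of `X (n + 1) mod 10 ^ (n + 1)` modulo `2 * 5 ^ (n + 1)` are the same number, and `0` otherwise. -/
def shift (X : ℕ → ℤ) (n : ℕ) : ℤ :=
  if X n % 10 ^ n % (2 * 5 ^ n) = X (n + 1) % 10 ^ (n + 1) % (2 * 5 ^ (n + 1)) then 1 else 0

/-- `((X n mod 10 ^ n) mod 2 * 5 ^ n) + λ(n) * 2 * 5 ^ n`. -/
def leastBase (X : ℕ → ℤ) (n : ℕ) : ℤ :=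
  X n % 10 ^ n % (2 * 5 ^ n) + shift X n * (2 * 5 ^ n)

/-- The numbers `leastBase X n + k * 2 * 5 ^ n` for the `k ≥ 0` outside the residue class modulo `5`
of `(leastBase X (n + 1) - leastBase X n) / (2 * 5 ^ n)`. -/
def evenRootClass (X : ℕ → ℤ) (n : ℕ) : Set ℕ :=
  {a | ∃ k : ℕ, ¬ (k : ℤ) ≡ (leastBase X (n + 1) - leastBase X n) / (2 * 5 ^ n) [ZMOD 5] ∧
    (a : ℤ) = leastBase X n + k * (2 * 5 ^ n)}

/-- For every `n`, `X n mod 10 ^ n` is the residue of one and the same `10`-adic integer `y`, and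
`y ^ 5 = y`. -/
def IsRootSequence (X : ℕ → ℤ) : Prop :=
  ∀ n, X (n + 1) ≡ X n [ZMOD 10 ^ n] ∧ X n ^ 5 ≡ X n [ZMOD 10 ^ n]

/-- The approximations to the `10`-adic roots of `y ^ 5 = y`, built from `5 ^ (2 ^ n)` and
`2 ^ (5 ^ n)`. -/
def root1 (n : ℕ) : ℤ := 2 ^ (4 * 5 ^ n + 1) - 1

def root2 (n : ℕ) : ℤ := 2 ^ 5 ^ n

def root3 (n : ℕ) : ℤ := 5 ^ 2 ^ n - 2 ^ 5 ^ n

def root3' (n : ℕ) : ℤ := -5 ^ 2 ^ n - 2 ^ 5 ^ n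

def root7 (n : ℕ) : ℤ := 2 ^ 5 ^ n - 5 ^ 2 ^ n

def root7' (n : ℕ) : ℤ := 5 ^ 2 ^ n + 2 ^ 5 ^ n

def root8 (n : ℕ) : ℤ := -2 ^ 5 ^ n

def root9 (n : ℕ) : ℤ := 2 * 5 ^ 2 ^ n - 1

/-!
The last digits of a power tower are governed by the valuations at `2` and `5` of the differences
`gap a b` of consecutive towers: the number of stable digits at height `b` is the smaller of the two
(`stableDigits_iff`). Since `gap a (b + 1) = a ^ tetration a b * (a ^ gap a b - 1)`, lifting the
exponent shows that the `2`-adic valuation for odd `a` grows by exactly `v₂(a² - 1) - 1` in each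
step, and the `5`-adic valuation for `5 ∤ a` by `v₅(a⁴ - 1)`, once `4 ∣ gap a b`. At a prime dividing
`a` the valuation grows like the tower itself and is irrelevant. Elementary bounds show that from
height `a` on the valuation with the smaller growth rate is also the smaller one, so the speed is the
minimum of the rates at the primes among `2` and `5` that do not divide `a` (`hasSpeedAt_speed`).

Hence the speed is at least `n` exactly when `a` is a fourth root of unity modulo `5 ^ n` (if `5 ∤ a`)
and `±1` modulo `2 ^ n` (if `2 ∤ a`); this is `hasSpeed_iff` with `two_pow_dvd_iff`. A fourth root of
unity modulo `5 ^ n` is determined by its residue modulo `5` (`five_pow_dvd_iff`), so for each last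
digit prime to `10` there are two decadic roots of `y ^ 5 = y` such that the speed of `a` is at least
`n` exactly when `a` agrees with one of them modulo `10 ^ n` (`speedSet_eq_union`). For an even last
digit only the congruence modulo `5 ^ n` is left (`speedSet_eq_evenRootClass`, `speedSet_four`,
`speedSet_six`), for the last digit `5` only the one modulo `2 ^ n` (`speedSet_five`). The explicit
sequences approximate these roots because `5 ^ 2 ^ n` tends to `1` in `ℤ₂` and to `0` in `ℤ₅`, while
`2 ^ 5 ^ n` tends to `0` in `ℤ₂` and to the fourth root of unity above `2` in `ℤ₅`
(`isLift_combination`).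
-/

/-! ### Growth of power towers -/

theorem lt_tetration {a : ℕ} (ha : 2 ≤ a) (b : ℕ) : b < tetration a b := by
  induction b with
  | zero => simp [tetration]
  | succ b ih =>
    have h : tetration a b < a ^ tetration a b := Nat.lt_pow_self ha
    rw [tetration]
    omega

theorem tetration_lt_succ {a : ℕ} (ha : 2 ≤ a) (b : ℕ) :
    tetration a b < tetration a (b + 1) :=
  Nat.lt_pow_self ha

/-- A crude quadratic lower bound for towers; it dominates the linear growth of the smaller of the
two valuations of `gap a b`. -/
theorem quadratic_le_tetration {a b : ℕ} (ha : 4 ≤ a) (hb : 2 ≤ b) :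
    2 * (b + 1) ^ 2 + (b + 1) ≤ tetration a b := by
  induction b, hb using Nat.le_induction with
  | base =>
    have h : 4 ^ 4 ≤ a ^ a := (Nat.pow_le_pow_left ha 4).trans (Nat.pow_le_pow_right (by omega) ha)
    simp only [tetration, pow_one]
    omega
  | succ b hb ih =>
    have h1 : tetration a b < 2 ^ tetration a b := Nat.lt_two_pow_self
    have h2 : 4 ^ tetration a b ≤ a ^ tetration a b := Nat.pow_le_pow_left ha _
    have h3 : 4 ^ tetration a b = 2 ^ tetration a b * 2 ^ tetration a b := by
      rw [← mul_pow]; norm_num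
    rw [tetration]
    nlinarith

/-- The difference between the towers of heights `b + 1` and `b`. -/
def gap (a b : ℕ) : ℕ := tetration a (b + 1) - tetration a b

theorem gap_ne_zero {a : ℕ} (ha : 2 ≤ a) (b : ℕ) : gap a b ≠ 0 :=
  Nat.sub_ne_zero_of_lt (tetration_lt_succ ha b)

theorem gap_zero (a : ℕ) : gap a 0 = a - 1 := by simp [gap, tetration]

theorem gap_succ {a : ℕ} (ha : 2 ≤ a) (b : ℕ) :
    gap a (b + 1) = a ^ tetration a b * (a ^ gap a b - 1) := by
  rw [Nat.mul_sub, ← pow_add, gap, gap, Nat.add_sub_cancel' (tetration_lt_succ ha b).le]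
  simp [tetration]

theorem pow_sub_one_ne_zero {a m : ℕ} (ha : 2 ≤ a) (hm : m ≠ 0) : a ^ m - 1 ≠ 0 :=
  Nat.sub_ne_zero_of_lt (Nat.one_lt_pow hm ha)

instance fact_prime_five : Fact (Nat.Prime 5) := ⟨Nat.prime_five⟩

/-! ### Stable digits and the valuations of the gaps -/

theorem ten_pow_dvd_iff {m d : ℕ} (hm : m ≠ 0) :
    10 ^ d ∣ m ↔ d ≤ min (padicValNat 2 m) (padicValNat 5 m) := by
  rw [show (10 : ℕ) = 2 * 5 from rfl, mul_pow, le_min_iff, ← padicValNat_dvd_iff_le hm,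
    ← padicValNat_dvd_iff_le hm]
  have hc : Nat.Coprime (2 ^ d) (5 ^ d) := Nat.Coprime.pow _ _ (by norm_num)
  exact ⟨fun h => ⟨(dvd_mul_right _ _).trans h, (dvd_mul_left _ _).trans h⟩,
    fun h => hc.mul_dvd_of_dvd_of_dvd h.1 h.2⟩

theorem stableDigits_iff {a : ℕ} (ha : 2 ≤ a) (b d : ℕ) :
    StableDigits a b d ↔ d = min (padicValNat 2 (gap a b)) (padicValNat 5 (gap a b)) := by
  rw [StableDigits, Nat.modEq_iff_dvd' (tetration_lt_succ ha b).le,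
    Nat.modEq_iff_dvd' (tetration_lt_succ ha b).le]
  change 10 ^ d ∣ gap a b ∧ ¬ 10 ^ (d + 1) ∣ gap a b ↔ _
  rw [ten_pow_dvd_iff (gap_ne_zero ha b), ten_pow_dvd_iff (gap_ne_zero ha b)]
  omega

theorem hasSpeedAt_iff {a : ℕ} (ha : 2 ≤ a) (b v : ℕ) :
    HasSpeedAt a b v ↔ min (padicValNat 2 (gap a b)) (padicValNat 5 (gap a b)) =
      min (padicValNat 2 (gap a (b - 1))) (padicValNat 5 (gap a (b - 1))) + v := by
  simp only [HasSpeedAt, stableDigits_iff ha]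
  exact ⟨fun ⟨d, h1, h2⟩ => by rw [← h1, ← h2], fun h => ⟨_, rfl, h.symm⟩⟩

/-! ### Linear growth of the two valuations -/

/-- The increment of the `2`-adic valuation of the gaps of an odd base. -/
def twoRate (a : ℕ) : ℕ := padicValNat 2 (a ^ 2 - 1) - 1

/-- The eventual increment of the `5`-adic valuation of the gaps of a base prime to `5`. -/
def fiveRate (a : ℕ) : ℕ := padicValNat 5 (a ^ 4 - 1)

theorem sub_one_mul_add_one (a : ℕ) : a ^ 2 - 1 = (a + 1) * (a - 1) := by
  simpa using Nat.sq_sub_sq a 1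

theorem padicValNat_two_pow_sub_one {a m : ℕ} (ha : 2 ≤ a) (hodd : ¬ 2 ∣ a) (hm : m ≠ 0)
    (heven : Even m) : padicValNat 2 (a ^ m - 1) = twoRate a + padicValNat 2 m := by
  have h := padicValNat.pow_two_sub_one (by omega) hodd hm heven
  have h1 : 1 ≤ padicValNat 2 (a - 1) :=
    one_le_padicValNat_of_dvd (by omega) (by omega)
  rw [twoRate, sub_one_mul_add_one, padicValNat.mul (by omega) (by omega)]
  omega

theorem padicValNat_five_pow_sub_one {a m : ℕ} (ha : 2 ≤ a) (h5 : ¬ 5 ∣ a) (hm : m ≠ 0)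
    (h4 : 4 ∣ m) : padicValNat 5 (a ^ m - 1) = fiveRate a + padicValNat 5 m := by
  obtain ⟨k, rfl⟩ := h4
  have hk : k ≠ 0 := by rintro rfl; simp at hm
  have hd : 5 ∣ a ^ 4 - 1 := by
    have h : a ^ 4 % 5 = 1 := by
      have : a % 5 = 1 ∨ a % 5 = 2 ∨ a % 5 = 3 ∨ a % 5 = 4 := by omega
      rcases this with h | h | h | h <;> simp [Nat.pow_mod, h]
    omega
  have h := padicValNat.pow_sub_pow (p := 5) (x := a ^ 4) (y := 1) (by decide)
    (Nat.one_lt_pow (by norm_num) ha) hd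
    (fun h => h5 (Nat.prime_five.dvd_of_dvd_pow h)) hk
  rw [one_pow, ← pow_mul] at h
  rw [h, padicValNat.mul (by norm_num) hk, fiveRate,
    padicValNat.eq_zero_of_not_dvd (show ¬ 5 ∣ 4 by norm_num), zero_add]

theorem padicValNat_five_pow_sub_one_le {a m : ℕ} (ha : 2 ≤ a) (h5 : ¬ 5 ∣ a) (hm : m ≠ 0) :
    padicValNat 5 (a ^ m - 1) ≤ fiveRate a + padicValNat 5 m := by
  have h := padicValNat_five_pow_sub_one ha h5 (m := m * 4) (by omega) (dvd_mul_left _ _)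
  rw [padicValNat.mul hm (by norm_num),
    padicValNat.eq_zero_of_not_dvd (show ¬ 5 ∣ 4 by norm_num), add_zero] at h
  rw [← h, ← padicValNat_dvd_iff_le (pow_sub_one_ne_zero ha (by omega)), pow_mul]
  exact pow_padicValNat_dvd.trans (by simpa using Nat.sub_dvd_pow_sub_pow (a ^ m) 1 4)

theorem padicValNat_gap_succ {p a : ℕ} [Fact p.Prime] (ha : 2 ≤ a) (hp : ¬ p ∣ a) (b : ℕ) :
    padicValNat p (gap a (b + 1)) = padicValNat p (a ^ gap a b - 1) := by
  rw [gap_succ ha, padicValNat.mul (pow_ne_zero _ (by omega))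
    (pow_sub_one_ne_zero ha (gap_ne_zero ha b)),
    padicValNat.eq_zero_of_not_dvd (fun h => hp ((Fact.out : p.Prime).dvd_of_dvd_pow h)), zero_add]

theorem odd_tetration {a : ℕ} (h2 : ¬ 2 ∣ a) (b : ℕ) : Odd (tetration a b) := by
  cases b with
  | zero => exact odd_one
  | succ b => exact (Nat.odd_iff.2 (by omega)).pow

theorem padicValNat_two_gap {a : ℕ} (ha : 2 ≤ a) (h2 : ¬ 2 ∣ a) (b : ℕ) :
    padicValNat 2 (gap a b) = padicValNat 2 (a - 1) + b * twoRate a := by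
  induction b with
  | zero => rw [gap_zero]; ring
  | succ b ih =>
    rw [padicValNat_gap_succ ha h2, padicValNat_two_pow_sub_one ha h2 (gap_ne_zero ha b)
      (Nat.Odd.sub_odd (odd_tetration h2 _) (odd_tetration h2 _)), ih]
    ring

theorem two_le_twoRate {a : ℕ} (ha : 2 ≤ a) (h2 : ¬ 2 ∣ a) : 2 ≤ twoRate a := by
  have h := padicValNat.pow_two_sub_one_ge (n := 2) (by omega) h2 (by norm_num) even_two
  rw [padicValNat_self] at h
  rw [twoRate]
  omega

/-- The differences of consecutive towers become divisible by `4`, the order of `(ℤ/5)ˣ`. -/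
theorem four_dvd_gap_of_odd {a b : ℕ} (ha : 2 ≤ a) (h2 : ¬ 2 ∣ a) (hb : 1 ≤ b) : 4 ∣ gap a b := by
  have h := two_le_twoRate ha h2
  rw [show 4 = 2 ^ 2 from rfl, padicValNat_dvd_iff_le (gap_ne_zero ha b),
    padicValNat_two_gap ha h2]
  exact le_add_left (h.trans (Nat.le_mul_of_pos_left _ hb))

theorem four_dvd_gap {a b : ℕ} (ha : 2 ≤ a) (hb : 2 ≤ b) : 4 ∣ gap a b := by
  by_cases h2 : 2 ∣ a
  · have h (c : ℕ) (hc : 1 ≤ c) : 4 ∣ tetration a (c + 1) :=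
      (pow_dvd_pow_of_dvd h2 2).trans (pow_dvd_pow a (by have := lt_tetration ha c; omega))
    obtain ⟨c, rfl⟩ : ∃ c, b = c + 1 := ⟨b - 1, by omega⟩
    exact Nat.dvd_sub (h _ (by omega)) (h _ (by omega))
  · exact four_dvd_gap_of_odd ha h2 (by omega)

theorem padicValNat_five_gap_succ {a b : ℕ} (ha : 2 ≤ a) (h5 : ¬ 5 ∣ a) (h4 : 4 ∣ gap a b) :
    padicValNat 5 (gap a (b + 1)) = padicValNat 5 (gap a b) + fiveRate a := by
  rw [padicValNat_gap_succ ha h5, padicValNat_five_pow_sub_one ha h5 (gap_ne_zero ha b) h4,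
    add_comm]

theorem padicValNat_five_gap_le {a : ℕ} (ha : 2 ≤ a) (h5 : ¬ 5 ∣ a) (b : ℕ) :
    padicValNat 5 (gap a b) ≤ padicValNat 5 (a - 1) + b * fiveRate a := by
  induction b with
  | zero => rw [gap_zero]; omega
  | succ b ih =>
    have h := padicValNat_five_pow_sub_one_le ha h5 (gap_ne_zero ha b)
    rw [padicValNat_gap_succ ha h5]
    linarith

theorem padicValNat_five_gap_of_odd {a b : ℕ} (ha : 2 ≤ a) (h2 : ¬ 2 ∣ a) (h5 : ¬ 5 ∣ a) :
    padicValNat 5 (gap a (b + 1)) = padicValNat 5 (gap a 1) + b * fiveRate a := by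
  induction b with
  | zero => simp
  | succ b ih =>
    rw [padicValNat_five_gap_succ ha h5 (four_dvd_gap_of_odd ha h2 (by omega)), ih]
    ring

/-- A prime divisor of the base divides the gaps to a tower-sized power. -/
theorem tetration_le_padicValNat_gap {p a : ℕ} [Fact p.Prime] (ha : 2 ≤ a) (hp : p ∣ a) (b : ℕ) :
    tetration a b ≤ padicValNat p (gap a (b + 1)) := by
  rw [← padicValNat_dvd_iff_le (gap_ne_zero ha _), gap_succ ha]
  exact (pow_dvd_pow_of_dvd hp _).trans (dvd_mul_right _ _)

/-! ### Which valuation is the smaller one -/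

theorem padicValNat_lt_of_lt_two_pow {p m k : ℕ} [hp : Fact p.Prime] (hm : m ≠ 0)
    (h : m < 2 ^ k) : padicValNat p m < k := by
  by_contra! hk
  have h1 : p ^ k ∣ m := (padicValNat_dvd_iff_le hm).2 hk
  have h2 := Nat.le_of_dvd (Nat.pos_of_ne_zero hm) h1
  have h3 : 2 ^ k ≤ p ^ k := Nat.pow_le_pow_left hp.out.two_le k
  omega

theorem padicValNat_sub_one_lt {p a : ℕ} [Fact p.Prime] (ha : 2 ≤ a) :
    padicValNat p (a - 1) < a := by
  have h : a < 2 ^ a := Nat.lt_two_pow_self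
  exact padicValNat_lt_of_lt_two_pow (by omega) (by omega)

theorem twoRate_le {a : ℕ} (ha : 2 ≤ a) : twoRate a ≤ 2 * a := by
  have h : a ^ 2 < 2 ^ (2 * a) := by
    rw [mul_comm, pow_mul]
    exact Nat.pow_lt_pow_left Nat.lt_two_pow_self (by norm_num)
  have := padicValNat_lt_of_lt_two_pow (p := 2) (pow_sub_one_ne_zero ha two_ne_zero)
    (show a ^ 2 - 1 < 2 ^ (2 * a) by omega)
  rw [twoRate]
  omega

theorem fiveRate_le {a : ℕ} (ha : 2 ≤ a) : fiveRate a ≤ 2 * a := by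
  by_contra! hk
  have h1 : 5 ^ (2 * a) ∣ a ^ 4 - 1 :=
    (padicValNat_dvd_iff_le (pow_sub_one_ne_zero ha four_ne_zero)).2 hk.le
  have h2 := Nat.le_of_dvd (Nat.pos_of_ne_zero (pow_sub_one_ne_zero ha four_ne_zero)) h1
  have h3 : a ^ 4 < (2 ^ a) ^ 4 := Nat.pow_lt_pow_left Nat.lt_two_pow_self (by norm_num)
  have h4 : (2 ^ a) ^ 4 ≤ 5 ^ (2 * a) := by
    rw [← pow_mul, mul_comm, pow_mul, pow_mul]
    exact Nat.pow_le_pow_left (by norm_num) a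
  omega

theorem five_le_two_of_even {a b : ℕ} (ha : 2 ≤ a) (h2 : 2 ∣ a) (h5 : ¬ 5 ∣ a) (hb : a ≤ b) :
    padicValNat 5 (gap a b) ≤ padicValNat 2 (gap a b) := by
  refine (padicValNat_five_gap_le ha h5 b).trans ?_
  obtain ⟨c, rfl⟩ : ∃ c, b = c + 1 := ⟨b - 1, by omega⟩
  refine le_trans ?_ (tetration_le_padicValNat_gap ha h2 c)
  rcases Nat.lt_or_ge a 4 with h | h
  · obtain rfl : a = 2 := by omega
    have h1 : fiveRate 2 = 1 := by
      rw [fiveRate, show 2 ^ 4 - 1 = 5 * 3 from rfl, padicValNat.mul (by norm_num) (by norm_num),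
        padicValNat_self, padicValNat.eq_zero_of_not_dvd (by norm_num)]
    have h3 := lt_tetration ha c
    rw [h1]
    simp only [Nat.add_one_sub_one, padicValNat_one_right]
    omega
  · have h1 := fiveRate_le ha
    have h3 := quadratic_le_tetration h (b := c) (by omega)
    have h4 := padicValNat_sub_one_lt (p := 5) ha
    nlinarith [Nat.mul_le_mul_left (c + 1) (h1.trans (Nat.mul_le_mul_left 2 hb))]

theorem two_le_five_of_five_dvd {a b : ℕ} (ha : 2 ≤ a) (h2 : ¬ 2 ∣ a) (h5 : 5 ∣ a) (hb : a ≤ b) :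
    padicValNat 2 (gap a b) ≤ padicValNat 5 (gap a b) := by
  rw [padicValNat_two_gap ha h2]
  obtain ⟨c, rfl⟩ : ∃ c, b = c + 1 := ⟨b - 1, by omega⟩
  refine le_trans ?_ (tetration_le_padicValNat_gap ha h5 c)
  have h : 5 ≤ a := Nat.le_of_dvd (by omega) h5
  have h1 := twoRate_le ha
  have h3 := quadratic_le_tetration (a := a) (b := c) (by omega) (by omega)
  have h4 := padicValNat_sub_one_lt (p := 2) ha
  nlinarith [Nat.mul_le_mul_left (c + 1) (h1.trans (Nat.mul_le_mul_left 2 hb))]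

theorem cube_lt_two_pow {a : ℕ} (ha : 10 ≤ a) : a ^ 3 < 2 ^ a := by
  induction a, ha using Nat.le_induction with
  | base => norm_num
  | succ a ha ih =>
    rw [pow_succ 2]
    nlinarith [Nat.mul_le_mul_right (a ^ 2) ha, Nat.mul_le_mul_right a ha]

/-- If the `5`-adic valuation grows faster, it is already the larger one at height `a`. -/
theorem two_le_five_of_lt {a b : ℕ} (ha : 2 ≤ a) (h2 : ¬ 2 ∣ a) (h5 : ¬ 5 ∣ a)
    (hlt : twoRate a < fiveRate a) (hb : a ≤ b) :
    padicValNat 2 (gap a b) ≤ padicValNat 5 (gap a b) := by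
  obtain ⟨c, rfl⟩ : ∃ c, b = c + 1 := ⟨b - 1, by omega⟩
  have h10 : 10 ≤ a := by
    -- the assumption forces `5 ^ 3 ∣ a ^ 4 - 1`, which excludes the small bases
    have h3 : 5 ^ 3 ∣ a ^ 4 - 1 := by
      have := two_le_twoRate ha h2
      exact (padicValNat_dvd_iff_le (pow_sub_one_ne_zero ha four_ne_zero)).2
        (show 3 ≤ fiveRate a by omega)
    by_contra! h
    interval_cases a <;> revert h3 <;> decide
  have h1 : padicValNat 2 (a - 1) + (twoRate a + 1) < a := by
    have h3 := padicValNat_lt_of_lt_two_pow (p := 2) (k := a) (m := (a - 1) * (a ^ 2 - 1))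
      (mul_ne_zero (by omega) (pow_sub_one_ne_zero ha two_ne_zero)) (by
        refine lt_of_le_of_lt ?_ (cube_lt_two_pow h10)
        rw [pow_succ' a 2]
        exact Nat.mul_le_mul (Nat.sub_le _ _) (Nat.sub_le _ _))
    rw [padicValNat.mul (by omega) (pow_sub_one_ne_zero ha two_ne_zero)] at h3
    have := two_le_twoRate ha h2
    rw [twoRate] at *
    omega
  rw [padicValNat_two_gap ha h2, padicValNat_five_gap_of_odd ha h2 h5]
  have : c * (twoRate a + 1) ≤ c * fiveRate a := Nat.mul_le_mul_left c hlt
  rw [add_one_mul]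
  rw [mul_add_one] at this
  omega

/-- If the `2`-adic valuation grows faster, it is already the larger one at height `a`. -/
theorem five_le_two_of_lt {a b : ℕ} (ha : 2 ≤ a) (h2 : ¬ 2 ∣ a) (h5 : ¬ 5 ∣ a)
    (hlt : fiveRate a < twoRate a) (hb : a ≤ b) :
    padicValNat 5 (gap a b) ≤ padicValNat 2 (gap a b) := by
  refine (padicValNat_five_gap_le ha h5 b).trans ?_
  have h4 := padicValNat_sub_one_lt (p := 5) ha
  rw [padicValNat_two_gap ha h2]
  have : b * (fiveRate a + 1) ≤ b * twoRate a := Nat.mul_le_mul_left b hlt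
  rw [mul_add_one] at this
  omega

/-! ### The congruence speed -/

/-- The congruence speed in closed form: the smaller of the growth rates of the valuations of the
gaps at those primes among `2` and `5` that do not divide the base. -/
def speed (a : ℕ) : ℕ :=
  if 2 ∣ a then fiveRate a else if 5 ∣ a then twoRate a else min (twoRate a) (fiveRate a)

theorem hasSpeedAt_speed {a b : ℕ} (h10 : ¬ 10 ∣ a) (ha : 2 ≤ a) (hb : a < b) :
    HasSpeedAt a b (speed a) := by
  obtain ⟨c, rfl⟩ : ∃ c, b = c + 1 := ⟨b - 1, by omega⟩
  rw [hasSpeedAt_iff ha, Nat.add_sub_cancel, speed]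
  split_ifs with h2 h5
  · have h5 : ¬ 5 ∣ a := by omega
    rw [min_eq_right (five_le_two_of_even ha h2 h5 (by omega)),
      min_eq_right (five_le_two_of_even ha h2 h5 (by omega)),
      padicValNat_five_gap_succ ha h5 (four_dvd_gap ha (by omega))]
  · rw [min_eq_left (two_le_five_of_five_dvd ha h2 h5 (by omega)),
      min_eq_left (two_le_five_of_five_dvd ha h2 h5 (by omega)),
      padicValNat_two_gap ha h2, padicValNat_two_gap ha h2]
    ring
  · have e2 : padicValNat 2 (gap a (c + 1)) = padicValNat 2 (gap a c) + twoRate a := by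
      rw [padicValNat_two_gap ha h2, padicValNat_two_gap ha h2]
      ring
    have e5 := padicValNat_five_gap_succ ha h5 (four_dvd_gap ha (b := c) (by omega))
    rcases lt_trichotomy (twoRate a) (fiveRate a) with h | h | h
    · have := two_le_five_of_lt ha h2 h5 h (b := c) (by omega)
      omega
    · omega
    · have := five_le_two_of_lt ha h2 h5 h (b := c) (by omega)
      omega

theorem hasSpeed_iff_eq_speed {a n : ℕ} (h10 : ¬ 10 ∣ a) (ha : 2 ≤ a) :
    HasSpeed a n ↔ n = speed a := by
  constructor
  · rintro ⟨-, h | ⟨-, h⟩⟩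
    · omega
    · have h1 := (hasSpeedAt_iff ha _ _).1 (h (a + 1) (by omega))
      have h2 := (hasSpeedAt_iff ha _ _).1 (hasSpeedAt_speed h10 ha (Nat.lt_succ_self a))
      rw [Nat.succ_eq_add_one] at h2
      omega
  · rintro rfl
    exact ⟨h10, Or.inr ⟨ha, fun b hb => hasSpeedAt_speed h10 ha hb⟩⟩

theorem existsUnique_hasSpeed {a : ℕ} (h10 : ¬ 10 ∣ a) : ∃! n, HasSpeed a n := by
  rcases Nat.lt_or_ge a 2 with h | h
  · obtain rfl : a = 1 := by
      by_contra h1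
      exact h10 ((show a = 0 by omega) ▸ dvd_zero 10)
    refine ⟨0, ⟨h10, Or.inl ⟨rfl, rfl⟩⟩, ?_⟩
    rintro n ⟨-, ⟨-, hn⟩ | ⟨h, -⟩⟩
    · exact hn
    · omega
  · exact ⟨speed a, (hasSpeed_iff_eq_speed h10 h).2 rfl,
      fun n hn => (hasSpeed_iff_eq_speed h10 h).1 hn⟩

/-- The congruences that hold exactly when the speed of a base `a ≥ 2` is at least `n`
(see `speedGe_iff`); they hold for all `n` if `a = 1`. -/
def SpeedGe (a n : ℕ) : Prop :=
  (5 ∣ a ∨ (5 : ℤ) ^ n ∣ (a : ℤ) ^ 4 - 1) ∧ (2 ∣ a ∨ (2 : ℤ) ^ (n + 1) ∣ (a : ℤ) ^ 2 - 1)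

theorem natCast_pow_dvd_pow_sub_one {p a m n : ℕ} [Fact p.Prime] (ha : 2 ≤ a) (hm : m ≠ 0) :
    (p : ℤ) ^ n ∣ (a : ℤ) ^ m - 1 ↔ n ≤ padicValNat p (a ^ m - 1) := by
  rw [← padicValNat_dvd_iff_le (pow_sub_one_ne_zero ha hm), ← Int.natCast_dvd_natCast,
    Nat.cast_sub (Nat.one_le_pow _ _ (by omega))]
  push_cast
  rfl

theorem speedGe_iff {a n : ℕ} (h10 : ¬ 10 ∣ a) (ha : 2 ≤ a) : SpeedGe a n ↔ n ≤ speed a := by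
  have e5 := natCast_pow_dvd_pow_sub_one (p := 5) (n := n) ha four_ne_zero
  have e2 := natCast_pow_dvd_pow_sub_one (p := 2) (n := n + 1) ha two_ne_zero
  push_cast at e5 e2
  have et (h : ¬ 2 ∣ a) : n + 1 ≤ padicValNat 2 (a ^ 2 - 1) ↔ n ≤ twoRate a := by
    have := two_le_twoRate ha h
    rw [twoRate] at *
    omega
  rw [SpeedGe, e5, e2, speed]
  change (_ ∨ n ≤ fiveRate a) ∧ _ ↔ _
  split_ifs with h2 h5
  · have h5 : ¬ 5 ∣ a := by omega
    simp [h2, h5]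
  · simp [h2, h5, et]
  · simp [h2, h5, et, and_comm]

theorem hasSpeed_iff {a n : ℕ} (h10 : ¬ 10 ∣ a) (hn : n ≠ 0) :
    HasSpeed a n ↔ SpeedGe a n ∧ ¬ SpeedGe a (n + 1) := by
  rcases Nat.lt_or_ge a 2 with h | ha
  · obtain rfl : a = 1 := by
      by_contra h1
      exact h10 ((show a = 0 by omega) ▸ dvd_zero 10)
    simp [HasSpeed, SpeedGe, hn]
  · rw [hasSpeed_iff_eq_speed h10 ha, speedGe_iff h10 ha, speedGe_iff h10 ha]
    omega

theorem mem_speedSet_iff {a s n : ℕ} (hs : ¬ 10 ∣ s) (hn : n ≠ 0) :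
    a ∈ speedSet s n ↔ a ≡ s [MOD 10] ∧ SpeedGe a n ∧ ¬ SpeedGe a (n + 1) :=
  and_congr_right fun h => hasSpeed_iff (fun h10 => hs ((h.dvd_iff dvd_rfl).1 h10)) hn

/-! ### Roots of unity modulo powers of `5` and of `2` -/

theorem modEq_ten_pow_iff {a b : ℤ} {n : ℕ} :
    a ≡ b [ZMOD 10 ^ n] ↔ a ≡ b [ZMOD 2 ^ n] ∧ a ≡ b [ZMOD 5 ^ n] := by
  rw [show (10 : ℤ) = 2 * 5 from rfl, mul_pow, Int.modEq_and_modEq_iff_modEq_mul]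
  simpa [Int.natAbs_pow] using Nat.Coprime.pow n n (show Nat.Coprime 2 5 by norm_num)

theorem pow_dvd_left_of_not_dvd {p n : ℕ} (hp : p.Prime) {x y : ℤ} (hy : ¬ (p : ℤ) ∣ y) :
    (p : ℤ) ^ n ∣ x * y ↔ (p : ℤ) ^ n ∣ x :=
  ⟨fun h => (((Nat.prime_iff_prime_int.1 hp).coprime_iff_not_dvd.2 hy).pow_left).dvd_of_dvd_mul_right
    h, fun h => h.mul_right y⟩

/-- Uniqueness of Hensel lifts: a fourth root of unity modulo `5 ^ n` is determined by its residue
modulo `5`. -/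
theorem five_pow_dvd_iff {a y : ℤ} {n : ℕ} (h5 : ¬ 5 ∣ y) (hy : 5 ^ n ∣ y ^ 4 - 1)
    (h : a ≡ y [ZMOD 5]) : 5 ^ n ∣ a ^ 4 - 1 ↔ a ≡ y [ZMOD 5 ^ n] := by
  have hc : ¬ 5 ∣ a ^ 3 + a ^ 2 * y + a * y ^ 2 + y ^ 3 := by
    intro hd
    have e : a ^ 3 + a ^ 2 * y + a * y ^ 2 + y ^ 3 ≡ 4 * y ^ 3 [ZMOD 5] := by
      calc _ ≡ y ^ 3 + y ^ 2 * y + y * y ^ 2 + y ^ 3 [ZMOD 5] := by gcongr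
        _ = 4 * y ^ 3 := by ring
    have hp : Prime (5 : ℤ) := Nat.prime_iff_prime_int.1 Nat.prime_five
    rcases hp.dvd_or_dvd (e.dvd_iff.1 hd) with h4 | h4
    · norm_num at h4
    · exact h5 (hp.dvd_of_dvd_pow h4)
  have e : a ^ 4 - 1 = (a - y) * (a ^ 3 + a ^ 2 * y + a * y ^ 2 + y ^ 3) + (y ^ 4 - 1) := by ring
  rw [e, Int.dvd_add_left hy, Int.modEq_comm, Int.modEq_iff_dvd]
  exact pow_dvd_left_of_not_dvd Nat.prime_five hc

/-- The square roots of `1` modulo `2 ^ (n + 1)` are the integers that are `±1` modulo `2 ^ n`. -/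
theorem two_pow_dvd_iff {a : ℤ} {n : ℕ} (ha : Odd a) (hn : n ≠ 0) :
    2 ^ (n + 1) ∣ a ^ 2 - 1 ↔ a ≡ 1 [ZMOD 2 ^ n] ∨ a ≡ -1 [ZMOD 2 ^ n] := by
  obtain ⟨m, rfl⟩ := ha
  obtain ⟨k, rfl⟩ := Nat.exists_eq_succ_of_ne_zero hn
  rw [Int.modEq_comm, Int.modEq_iff_dvd, Int.modEq_comm (b := -1), Int.modEq_iff_dvd]
  have e1 : (2 * m + 1) ^ 2 - 1 = 2 ^ 2 * (m * (m + 1)) := by ring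
  have e2 : 2 * m + 1 - 1 = 2 * m := by ring
  have e3 : 2 * m + 1 - -1 = 2 * (m + 1) := by ring
  rw [e1, e2, e3, show (2 : ℤ) ^ (k.succ + 1) = 2 ^ 2 * 2 ^ k by rw [Nat.succ_eq_add_one]; ring,
    Nat.succ_eq_add_one, pow_succ' _ k, mul_dvd_mul_iff_left (by norm_num),
    mul_dvd_mul_iff_left two_ne_zero, mul_dvd_mul_iff_left two_ne_zero]
  refine ⟨fun h => ?_, fun h => h.elim (·.mul_right _) (·.mul_left _)⟩
  by_cases hm : 2 ∣ m
  · exact Or.inl ((pow_dvd_left_of_not_dvd Nat.prime_two (by push_cast; omega)).1 h)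
  · exact Or.inr ((pow_dvd_left_of_not_dvd Nat.prime_two hm).1 (mul_comm m _ ▸ h))

theorem speedGe_iff_of_even {a n : ℕ} (h2 : 2 ∣ a) (h5 : ¬ 5 ∣ a) :
    SpeedGe a n ↔ (5 : ℤ) ^ n ∣ (a : ℤ) ^ 4 - 1 := by
  simp [SpeedGe, h2, h5]

theorem speedGe_iff_of_odd {a n : ℕ} (h2 : ¬ 2 ∣ a) (hn : n ≠ 0) :
    SpeedGe a n ↔ (5 ∣ a ∨ (5 : ℤ) ^ n ∣ (a : ℤ) ^ 4 - 1) ∧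
      ((a : ℤ) ≡ 1 [ZMOD 2 ^ n] ∨ (a : ℤ) ≡ -1 [ZMOD 2 ^ n]) := by
  rw [SpeedGe, ← two_pow_dvd_iff (Int.odd_iff.2 (by omega)) hn]
  simp [h2]

/-! ### Decadic roots of `y ^ 5 = y` -/

/-- `X n` approximates modulo `10 ^ n` the decadic integer whose `2`-adic component is `ε` and whose
`5`-adic component is the fourth root of unity congruent to `s` modulo `5`. -/
structure IsLift (s ε : ℤ) (X : ℕ → ℤ) : Prop where
  two : ∀ n, X n ≡ ε [ZMOD 2 ^ n]
  five : ∀ n, 5 ^ n ∣ X n ^ 4 - 1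
  res : ∀ n, X n ≡ s [ZMOD 5]

namespace IsLift

variable {s ε : ℤ} {X : ℕ → ℤ}

theorem not_five_dvd (hX : IsLift s ε X) (hs : ¬ 5 ∣ s) (n : ℕ) : ¬ 5 ∣ X n :=
  fun h => hs ((hX.res n).dvd_iff.1 h)

theorem modEq_five_pow_iff (hX : IsLift s ε X) (hs : ¬ 5 ∣ s) {a : ℤ} (ha : a ≡ s [ZMOD 5]) (n : ℕ) :
    a ≡ X n [ZMOD 5 ^ n] ↔ 5 ^ n ∣ a ^ 4 - 1 :=
  (five_pow_dvd_iff (hX.not_five_dvd hs n) (hX.five n) (ha.trans (hX.res n).symm)).symm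

theorem modEq_ten_pow_iff (hX : IsLift s ε X) (hs : ¬ 5 ∣ s) {a : ℤ} (ha : a ≡ s [ZMOD 5]) (n : ℕ) :
    a ≡ X n [ZMOD 10 ^ n] ↔ a ≡ ε [ZMOD 2 ^ n] ∧ 5 ^ n ∣ a ^ 4 - 1 := by
  rw [_root_.modEq_ten_pow_iff, hX.modEq_five_pow_iff hs ha]
  exact and_congr_left fun _ => ⟨fun h => h.trans (hX.two n), fun h => h.trans (hX.two n).symm⟩

theorem succ_modEq (hX : IsLift s ε X) (hs : ¬ 5 ∣ s) (n : ℕ) : X (n + 1) ≡ X n [ZMOD 10 ^ n] :=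
  (hX.modEq_ten_pow_iff hs (hX.res _) n).2
    ⟨(hX.two (n + 1)).of_dvd (pow_dvd_pow 2 n.le_succ),
      (pow_dvd_pow 5 n.le_succ).trans (hX.five (n + 1))⟩

theorem isRootSequence (hX : IsLift s ε X) (hs : ¬ 5 ∣ s) (hε : ε ^ 5 = ε) : IsRootSequence X := by
  refine fun n => ⟨hX.succ_modEq hs n, _root_.modEq_ten_pow_iff.2 ⟨?_, ?_⟩⟩
  · calc X n ^ 5 ≡ ε ^ 5 [ZMOD 2 ^ n] := (hX.two n).pow 5
      _ = ε := hε
      _ ≡ X n [ZMOD 2 ^ n] := (hX.two n).symm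
  · rw [Int.modEq_comm, Int.modEq_iff_dvd, show X n ^ 5 - X n = (X n ^ 4 - 1) * X n by ring]
    exact (hX.five n).mul_right _

end IsLift

theorem mem_rootClass_iff {X : ℕ → ℤ} {n : ℕ} (hX : X (n + 1) ≡ X n [ZMOD 10 ^ n]) {a : ℕ} :
    a ∈ rootClass X n ↔
      (a : ℤ) ≡ X n [ZMOD 10 ^ n] ∧ ¬ (a : ℤ) ≡ X (n + 1) [ZMOD 10 ^ (n + 1)] := by
  have h0 : (0 : ℤ) < 10 ^ n := by positivity
  have hd : nextDigit X n * 10 ^ n = X (n + 1) % 10 ^ (n + 1) - X n % 10 ^ n := by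
    refine Int.ediv_mul_cancel (Int.ModEq.dvd ?_)
    exact (Int.mod_modEq _ _).trans (hX.symm.trans
      ((Int.mod_modEq _ _).of_dvd (pow_dvd_pow 10 n.le_succ)).symm)
  have key (j : ℤ) : X n % 10 ^ n + j * 10 ^ n ≡ X (n + 1) [ZMOD 10 ^ (n + 1)] ↔
      j ≡ nextDigit X n [ZMOD 10] := by
    have e : X (n + 1) % 10 ^ (n + 1) - (X n % 10 ^ n + j * 10 ^ n) =
        10 ^ n * (nextDigit X n - j) := by linear_combination -hd
    rw [Int.modEq_iff_dvd (n := 10), ← mul_dvd_mul_iff_left h0.ne', ← e, ← pow_succ,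
      ← Int.modEq_iff_dvd]
    exact ⟨fun h => h.trans (Int.mod_modEq _ _).symm, fun h => h.trans (Int.mod_modEq _ _)⟩
  constructor
  · rintro ⟨j, hj, ha⟩
    rw [ha, key]
    refine ⟨?_, hj⟩
    rw [Int.ModEq, Int.add_mul_emod_self_right]
    exact Int.mod_modEq _ _
  · rintro ⟨h1, h2⟩
    have e : (a : ℤ) = X n % 10 ^ n + ((a / 10 ^ n : ℕ) : ℤ) * 10 ^ n := by
      rw [← h1.eq]
      push_cast
      rw [mul_comm, Int.emod_add_mul_ediv]
    exact ⟨a / 10 ^ n, fun h => h2 (e ▸ (key _).2 h), e⟩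

/-- Bases prime to `10`: both square roots `±1` of `1` modulo powers of `2` contribute a class. For
`n ≥ 2` they differ modulo `4`, so the classes do not interfere. -/
theorem speedSet_eq_union {s n : ℕ} (h2 : ¬ 2 ∣ s) (h5 : ¬ 5 ∣ s) (hn : 2 ≤ n) {X Y : ℕ → ℤ}
    (hX : IsLift s 1 X) (hY : IsLift s (-1) Y) :
    speedSet s n = rootClass X n ∪ rootClass Y n := by
  have h5s : ¬ (5 : ℤ) ∣ s := by omega
  ext a
  rw [mem_speedSet_iff (by omega) (by omega), Set.mem_union, mem_rootClass_iff (hX.succ_modEq h5s n),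
    mem_rootClass_iff (hY.succ_modEq h5s n)]
  by_cases ha : a ≡ s [MOD 10]
  · have ha5 : (a : ℤ) ≡ s [ZMOD 5] := by
      unfold Nat.ModEq at ha
      unfold Int.ModEq
      omega
    have h2a : ¬ 2 ∣ a := by unfold Nat.ModEq at ha; omega
    have h5a : ¬ 5 ∣ a := by unfold Nat.ModEq at ha; omega
    rw [speedGe_iff_of_odd h2a (by omega), speedGe_iff_of_odd h2a (by omega),
      hX.modEq_ten_pow_iff h5s ha5, hX.modEq_ten_pow_iff h5s ha5,
      hY.modEq_ten_pow_iff h5s ha5, hY.modEq_ten_pow_iff h5s ha5]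
    have hle (e : ℤ) (h : (a : ℤ) ≡ e [ZMOD 2 ^ (n + 1)]) : (a : ℤ) ≡ e [ZMOD 2 ^ n] :=
      h.of_dvd (pow_dvd_pow 2 n.le_succ)
    have hne : ¬ ((a : ℤ) ≡ 1 [ZMOD 2 ^ n] ∧ (a : ℤ) ≡ -1 [ZMOD 2 ^ n]) := by
      rintro ⟨h1, h2⟩
      have h := (h1.symm.trans h2).of_dvd (pow_dvd_pow 2 hn)
      norm_num [Int.ModEq] at h
    have h1 := hle 1
    have h1' := hle (-1)
    simp only [ha, h5a, false_or, true_and]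
    tauto
  · have hno (ε : ℤ) (Z : ℕ → ℤ) (hε : Odd ε) (hZ : IsLift s ε Z) :
        ¬ (a : ℤ) ≡ Z n [ZMOD 10 ^ n] := by
      intro h
      apply ha
      obtain ⟨h2', h5'⟩ := modEq_ten_pow_iff.1 h
      have e5 := (h5'.of_dvd (dvd_pow_self 5 (by omega))).trans (hZ.res n)
      have e2 := (h2'.trans (hZ.two n)).of_dvd (dvd_pow_self 2 (by omega))
      rw [Int.odd_iff] at hε
      unfold Int.ModEq at e2 e5
      unfold Nat.ModEq
      omega
    simp [ha, hno 1 X odd_one hX, hno (-1) Y (by decide) hY]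

/-! ### Even bases whose square is `-1` modulo `5` -/

section Even

variable {X : ℕ → ℤ} {s n : ℕ}

theorem two_mul_five_pow_dvd (hn : n ≠ 0) : (2 * 5 ^ n : ℤ) ∣ 10 ^ n := by
  rw [show (10 : ℤ) = 2 * 5 from rfl, mul_pow]
  exact mul_dvd_mul_right (dvd_pow_self 2 hn) _

theorem leastBase_eq (hn : n ≠ 0) : leastBase X n = X n % (2 * 5 ^ n) +
    (if X n % (2 * 5 ^ n) = X (n + 1) % (2 * 5 ^ (n + 1)) then 1 else 0) * (2 * 5 ^ n) := by
  rw [leastBase, shift, Int.emod_emod_of_dvd _ (two_mul_five_pow_dvd hn),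
    Int.emod_emod_of_dvd _ (two_mul_five_pow_dvd n.succ_ne_zero)]

theorem leastBase_modEq (hn : n ≠ 0) : leastBase X n ≡ X n [ZMOD 2 * 5 ^ n] := by
  rw [leastBase_eq hn, Int.ModEq, Int.add_mul_emod_self_right, Int.emod_emod_of_dvd _ dvd_rfl]

theorem mem_evenRootClass_iff (hn : n ≠ 0) (hX : X (n + 1) ≡ X n [ZMOD 2 * 5 ^ n]) {a : ℕ} :
    a ∈ evenRootClass X n ↔
      (a : ℤ) ≡ X n [ZMOD 2 * 5 ^ n] ∧ ¬ (a : ℤ) ≡ X (n + 1) [ZMOD 2 * 5 ^ (n + 1)] := by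
  have h0 : (0 : ℤ) < 2 * 5 ^ n := by positivity
  have hM : (2 * 5 ^ (n + 1) : ℤ) = 2 * 5 ^ n * 5 := by ring
  have hL1 := leastBase_modEq (X := X) n.succ_ne_zero
  rw [Nat.succ_eq_add_one] at hL1
  have hd : (leastBase X (n + 1) - leastBase X n) / (2 * 5 ^ n) * (2 * 5 ^ n) =
      leastBase X (n + 1) - leastBase X n := by
    refine Int.ediv_mul_cancel (Int.ModEq.dvd ?_)
    exact (leastBase_modEq hn).trans (hX.symm.trans (hL1.of_dvd ⟨5, hM⟩).symm)
  have key (k : ℤ) : leastBase X n + k * (2 * 5 ^ n) ≡ X (n + 1) [ZMOD 2 * 5 ^ (n + 1)] ↔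
      k ≡ (leastBase X (n + 1) - leastBase X n) / (2 * 5 ^ n) [ZMOD 5] := by
    have e : leastBase X (n + 1) - (leastBase X n + k * (2 * 5 ^ n)) =
        2 * 5 ^ n * ((leastBase X (n + 1) - leastBase X n) / (2 * 5 ^ n) - k) := by
      linear_combination -hd
    rw [Int.modEq_iff_dvd (n := 5), ← mul_dvd_mul_iff_left h0.ne', ← e, ← hM, ← Int.modEq_iff_dvd]
    exact ⟨fun h => h.trans hL1.symm, fun h => h.trans hL1⟩
  constructor
  · rintro ⟨k, hk, ha⟩
    rw [ha, key]
    refine ⟨?_, hk⟩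
    rw [Int.ModEq, Int.add_mul_emod_self_right]
    exact leastBase_modEq hn
  · rintro ⟨h1, h2⟩
    have e : (a : ℤ) = X n % (2 * 5 ^ n) + ((a / (2 * 5 ^ n) : ℕ) : ℤ) * (2 * 5 ^ n) := by
      rw [← h1.eq]
      push_cast
      rw [mul_comm (_ / _), Int.emod_add_mul_ediv]
    suffices h : ∃ k : ℕ, (a : ℤ) = leastBase X n + k * (2 * 5 ^ n) by
      obtain ⟨k, hk⟩ := h
      exact ⟨k, fun h => h2 (hk ▸ (key _).2 h), hk⟩
    rw [leastBase_eq hn]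
    split_ifs with hs
    · obtain ⟨k, hk⟩ : ∃ k, a / (2 * 5 ^ n) = k + 1 := by
        refine Nat.exists_eq_succ_of_ne_zero fun h => h2 ?_
        rw [e, h, hs]
        simpa using Int.mod_modEq _ _
      refine ⟨k, ?_⟩
      rw [e, hk]
      push_cast
      ring
    · exact ⟨a / (2 * 5 ^ n), by rw [zero_mul, add_zero]; exact e⟩

/-- The role of the shift: without it the least residue would be excluded if the next truncation
happens to give the same number. -/
theorem not_leastBase_modEq (hn : n ≠ 0) :
    ¬ leastBase X n ≡ X (n + 1) [ZMOD 2 * 5 ^ (n + 1)] := by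
  have h0 : (0 : ℤ) < 2 * 5 ^ n := by positivity
  have hM : (2 * 5 ^ (n + 1) : ℤ) = 5 * (2 * 5 ^ n) := by ring
  have hr := Int.emod_nonneg (X n) h0.ne'
  have hr' := Int.emod_lt_of_pos (X n) h0
  rw [leastBase_eq hn, Int.ModEq, hM]
  split_ifs with hs
  · rw [← hs, Int.emod_eq_of_lt (by omega) (by omega)]
    omega
  · rwa [zero_mul, add_zero, Int.emod_eq_of_lt hr (by omega)]

theorem isLeast_evenRootClass (hn : n ≠ 0) (hX : X (n + 1) ≡ X n [ZMOD 2 * 5 ^ n]) :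
    IsLeast ((fun a : ℕ => (a : ℤ)) '' evenRootClass X n) (leastBase X n) := by
  have h0 : (0 : ℤ) < 2 * 5 ^ n := by positivity
  constructor
  · have hpos : 0 ≤ leastBase X n := by
      have hr := Int.emod_nonneg (X n) h0.ne'
      rw [leastBase_eq hn]
      split_ifs <;> omega
    obtain ⟨m, hm⟩ := Int.eq_ofNat_of_zero_le hpos
    refine ⟨m, (mem_evenRootClass_iff hn hX).2 ?_, hm.symm⟩
    rw [← hm]
    exact ⟨leastBase_modEq hn, not_leastBase_modEq hn⟩
  · rintro _ ⟨a, ⟨k, -, ha⟩, rfl⟩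
    change leastBase X n ≤ (a : ℤ)
    rw [ha]
    have : 0 ≤ (k : ℤ) * (2 * 5 ^ n) := by positivity
    omega

theorem modEq_two_mul_five_pow_iff {a b : ℤ} :
    a ≡ b [ZMOD 2 * 5 ^ n] ↔ a ≡ b [ZMOD 2] ∧ a ≡ b [ZMOD 5 ^ n] := by
  rw [Int.modEq_and_modEq_iff_modEq_mul]
  simpa [Int.natAbs_pow] using Nat.Coprime.pow_right n (show Nat.Coprime 2 5 by norm_num)

theorem IsLift.modEq_two_mul_five_pow_iff (hX : IsLift s 0 X) (h5 : ¬ 5 ∣ s) (hn : n ≠ 0) {a : ℤ}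
    (ha : a ≡ s [ZMOD 5]) : a ≡ X n [ZMOD 2 * 5 ^ n] ↔ 2 ∣ a ∧ 5 ^ n ∣ a ^ 4 - 1 := by
  rw [_root_.modEq_two_mul_five_pow_iff, hX.modEq_five_pow_iff (by omega) ha]
  have h := (hX.two n).of_dvd (dvd_pow_self 2 hn)
  rw [← Int.modEq_zero_iff_dvd (n := 2)]
  exact and_congr_left fun _ => ⟨fun h' => h'.trans h, fun h' => h'.trans h.symm⟩

theorem IsLift.succ_modEq_of_even (hX : IsLift s 0 X) (h5 : ¬ 5 ∣ s) (hn : n ≠ 0) :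
    X (n + 1) ≡ X n [ZMOD 2 * 5 ^ n] :=
  (hX.succ_modEq (by omega) n).of_dvd (two_mul_five_pow_dvd hn)

theorem speedSet_eq_evenRootClass (h2 : 2 ∣ s) (h5 : ¬ 5 ∣ s) (hn : n ≠ 0) (hX : IsLift s 0 X) :
    speedSet s n = evenRootClass X n := by
  ext a
  rw [mem_speedSet_iff (by omega) hn, mem_evenRootClass_iff hn (hX.succ_modEq_of_even h5 hn)]
  by_cases ha : a ≡ s [MOD 10]
  · have ha5 : (a : ℤ) ≡ s [ZMOD 5] := by
      unfold Nat.ModEq at ha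
      unfold Int.ModEq
      omega
    have h2a : 2 ∣ a := by unfold Nat.ModEq at ha; omega
    have h5a : ¬ 5 ∣ a := by unfold Nat.ModEq at ha; omega
    rw [speedGe_iff_of_even h2a h5a, speedGe_iff_of_even h2a h5a,
      hX.modEq_two_mul_five_pow_iff h5 hn ha5,
      hX.modEq_two_mul_five_pow_iff h5 n.succ_ne_zero ha5]
    have h2a' : (2 : ℤ) ∣ a := by omega
    simp [ha, h2a']
  · have hno : ¬ (a : ℤ) ≡ X n [ZMOD 2 * 5 ^ n] := by
      intro h
      apply ha
      obtain ⟨e2, e5⟩ := modEq_two_mul_five_pow_iff.1 h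
      have e5 := (e5.of_dvd (dvd_pow_self 5 hn)).trans (hX.res n)
      have e2 := e2.trans ((hX.two n).of_dvd (dvd_pow_self 2 hn))
      unfold Int.ModEq at e2 e5
      unfold Nat.ModEq
      omega
    simp [ha, hno]

end Even

/-! ### The eight root sequences -/

theorem two_pow_dvd_five_pow_sub_one (n : ℕ) : (2 : ℤ) ^ n ∣ 5 ^ 2 ^ n - 1 := by
  have h := dvd_sub_pow_of_dvd_sub (R := ℤ) (p := 2) (a := 5) (b := 1) (by norm_num) n
  rw [one_pow] at h
  exact (pow_dvd_pow 2 n.le_succ).trans h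

theorem five_pow_dvd_sixteen_pow_sub_one (n : ℕ) : (5 : ℤ) ^ n ∣ 16 ^ 5 ^ n - 1 := by
  have h := dvd_sub_pow_of_dvd_sub (R := ℤ) (p := 5) (a := 16) (b := 1) (by norm_num) n
  rw [one_pow] at h
  exact (pow_dvd_pow 5 n.le_succ).trans h

theorem two_pow_five_pow_modEq (n : ℕ) : (2 : ℤ) ^ 5 ^ n ≡ 2 [ZMOD 5] := by
  induction n with
  | zero => rfl
  | succ n ih =>
    rw [pow_succ, pow_mul]
    exact (ih.pow 5).trans rfl

/-- `5 ^ 2 ^ n` tends to the decadic idempotent with components `1` and `0`, and `2 ^ 5 ^ n` to the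
root with components `0` and the fourth root of unity above `2`. -/
theorem isLift_combination {s d : ℤ} (e : ℤ) (hd : d ^ 4 = 1) (hs : 2 * d ≡ s [ZMOD 5]) :
    IsLift s e (fun n => e * 5 ^ 2 ^ n + d * 2 ^ 5 ^ n) where
  two n := by
    obtain ⟨x, hx⟩ := two_pow_dvd_five_pow_sub_one n
    obtain ⟨y, hy⟩ : (2 : ℤ) ^ n ∣ 2 ^ 5 ^ n :=
      pow_dvd_pow 2 (Nat.lt_pow_self (by norm_num : 1 < 5)).le
    rw [Int.modEq_comm, Int.modEq_iff_dvd]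
    exact ⟨e * x + d * y, by linear_combination e * hx + d * hy⟩
  five n := by
    have h5 : (5 : ℤ) ^ 2 ^ n ≡ 0 [ZMOD 5 ^ n] := Int.modEq_zero_iff_dvd.2
      (pow_dvd_pow 5 (Nat.lt_pow_self (by norm_num : 1 < 2)).le)
    have h : (e * 5 ^ 2 ^ n + d * 2 ^ 5 ^ n) ^ 4 ≡ 1 [ZMOD 5 ^ n] := by
      calc (e * 5 ^ 2 ^ n + d * 2 ^ 5 ^ n) ^ 4 ≡ (e * 0 + d * 2 ^ 5 ^ n) ^ 4 [ZMOD 5 ^ n] := by gcongr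
        _ = d ^ 4 * 16 ^ 5 ^ n := by
          rw [mul_zero, zero_add, mul_pow, ← pow_mul, mul_comm (5 ^ n), pow_mul]; norm_num
        _ = 16 ^ 5 ^ n := by rw [hd, one_mul]
        _ ≡ 1 [ZMOD 5 ^ n] :=
          (Int.modEq_iff_dvd.2 (five_pow_dvd_sixteen_pow_sub_one n)).symm
    exact Int.modEq_iff_dvd.1 h.symm
  res n := by
    have h5 : (5 : ℤ) ^ 2 ^ n ≡ 0 [ZMOD 5] := Int.modEq_zero_iff_dvd.2
      (dvd_pow_self 5 (by positivity))
    calc e * 5 ^ 2 ^ n + d * 2 ^ 5 ^ n ≡ e * 0 + d * 2 [ZMOD 5] :=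
          (h5.mul_left e).add ((two_pow_five_pow_modEq n).mul_left d)
      _ = 2 * d := by ring
      _ ≡ s [ZMOD 5] := hs

theorem isLift_const {e s : ℤ} (he : e ^ 4 = 1) (hs : e ≡ s [ZMOD 5]) : IsLift s e (fun _ => e) where
  two _ := rfl
  five _ := by simp [he]
  res _ := hs

theorem isLift_root2 : IsLift 2 0 root2 := by
  convert isLift_combination (s := 2) 0 (d := 1) (by norm_num) (by decide) using 2 with n
  rw [root2]; ring

theorem isLift_root8 : IsLift 8 0 root8 := by
  convert isLift_combination (s := 8) 0 (d := -1) (by norm_num) (by decide) using 2 with n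
  rw [root8]; ring

theorem isLift_root3 : IsLift 3 1 root3 := by
  convert isLift_combination (s := 3) 1 (d := -1) (by norm_num) (by decide) using 2 with n
  rw [root3]; ring

theorem isLift_root3' : IsLift 3 (-1) root3' := by
  convert isLift_combination (s := 3) (-1) (d := -1) (by norm_num) (by decide) using 2 with n
  rw [root3']; ring

theorem isLift_root7 : IsLift 7 (-1) root7 := by
  convert isLift_combination (s := 7) (-1) (d := 1) (by norm_num) (by decide) using 2 with n
  rw [root7]; ring

theorem isLift_root7' : IsLift 7 1 root7' := by
  convert isLift_combination (s := 7) 1 (d := 1) (by norm_num) (by decide) using 2 with n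
  rw [root7']; ring

theorem isLift_root1 : IsLift 1 (-1) root1 := by
  have e (n : ℕ) : root1 n = 2 * 16 ^ 5 ^ n - 1 := by
    rw [root1, pow_succ, pow_mul]; norm_num; ring
  refine ⟨fun n => ?_, fun n => ?_, fun n => ?_⟩
  · have h : (2 : ℤ) ^ n ∣ 2 ^ (4 * 5 ^ n + 1) := by
      have := Nat.lt_pow_self (n := n) (by norm_num : 1 < 5)
      exact pow_dvd_pow 2 (by omega)
    rw [Int.modEq_comm, Int.modEq_iff_dvd, root1]
    simpa using h
  · have h := (Int.modEq_iff_dvd.2 (five_pow_dvd_sixteen_pow_sub_one n)).symm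
    rw [e]
    exact Int.modEq_iff_dvd.1 ((((h.mul_left 2).sub_right 1).pow 4).trans rfl).symm
  · rw [e]
    have h : (16 : ℤ) ^ 5 ^ n ≡ 1 ^ 5 ^ n [ZMOD 5] := Int.ModEq.pow _ rfl
    rw [one_pow] at h
    exact ((h.mul_left 2).sub_right 1).trans rfl

theorem isLift_root9 : IsLift 9 1 root9 where
  two n := (((Int.modEq_iff_dvd.2 (two_pow_dvd_five_pow_sub_one n)).symm.mul_left 2).sub_right 1).trans
    rfl
  five n := by
    have h : (5 : ℤ) ^ 2 ^ n ≡ 0 [ZMOD 5 ^ n] := Int.modEq_zero_iff_dvd.2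
      (pow_dvd_pow 5 (Nat.lt_pow_self (by norm_num : 1 < 2)).le)
    exact Int.modEq_iff_dvd.1 ((((h.mul_left 2).sub_right 1).pow 4).trans rfl).symm
  res n := by
    have h : (5 : ℤ) ^ 2 ^ n ≡ 0 [ZMOD 5] := Int.modEq_zero_iff_dvd.2
      (dvd_pow_self 5 (by positivity))
    exact ((h.mul_left 2).sub_right 1).trans rfl

/-! ### The constant roots `1` and `-1` -/

theorem rootClass_one {n : ℕ} (hn : n ≠ 0) :
    rootClass (fun _ => 1) n = {a | ∃ k : ℕ, k % 10 ∈ ({0, 1, 2, 3, 4, 5, 6, 7, 8} : Set ℕ) ∧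
      a = 10 ^ n + 1 + k * 10 ^ n} := by
  have h1 (m : ℕ) (hm : m ≠ 0) : (1 : ℤ) % 10 ^ m = 1 :=
    Int.emod_eq_of_lt (by norm_num) (one_lt_pow₀ (by norm_num) hm)
  have hd : nextDigit (fun _ => 1) n = 0 := by
    simp [nextDigit, h1 n hn, h1 (n + 1) n.succ_ne_zero]
  ext a
  simp only [rootClass, hd, h1 n hn, Set.mem_ofPred_eq, Int.ModEq, Set.mem_insert_iff,
    Set.mem_singleton_iff]
  constructor
  · rintro ⟨j, hj, ha⟩
    obtain ⟨k, rfl⟩ : ∃ k, j = k + 1 := ⟨j - 1, by omega⟩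
    refine ⟨k, by omega, ?_⟩
    zify
    rw [ha]
    push_cast
    ring
  · rintro ⟨k, hk, ha⟩
    refine ⟨k + 1, by omega, ?_⟩
    rw [ha]
    push_cast
    ring

theorem rootClass_neg_one (n : ℕ) :
    rootClass (fun _ => -1) n = {a | ∃ k : ℕ, k % 10 ∈ ({0, 1, 2, 3, 4, 5, 6, 7, 8} : Set ℕ) ∧
      a = 10 ^ n - 1 + k * 10 ^ n} := by
  have h1 (m : ℕ) : (-1 : ℤ) % 10 ^ m = 10 ^ m - 1 := by
    have h : (0 : ℤ) < 10 ^ m := by positivity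
    rw [← Int.add_emod_right, Int.emod_eq_of_lt (by omega) (by omega)]
    ring
  have hd : nextDigit (fun _ => -1) n = 9 := by
    have h : (0 : ℤ) < 10 ^ n := by positivity
    rw [nextDigit, h1, h1, show (10 : ℤ) ^ (n + 1) - 1 - (10 ^ n - 1) = 9 * 10 ^ n by ring,
      Int.mul_ediv_cancel _ h.ne']
  have hp : 1 ≤ 10 ^ n := Nat.one_le_pow _ _ (by norm_num)
  ext a
  simp only [rootClass, hd, h1 n, Set.mem_ofPred_eq, Int.ModEq, Set.mem_insert_iff,
    Set.mem_singleton_iff]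
  refine exists_congr fun k => and_congr (by omega) ?_
  zify [hp]

/-! ### Last digits `4` and `6` -/

theorem five_pow_exactly_dvd_odd_iff {x n : ℕ} :
    (¬ 2 ∣ x ∧ 5 ^ n ∣ x ∧ ¬ 5 ^ (n + 1) ∣ x) ↔
      ∃ k : ℕ, k % 5 ∈ ({0, 1, 3, 4} : Set ℕ) ∧ x = 5 ^ n + k * (2 * 5 ^ n) := by
  have h0 : 5 ^ n ≠ 0 := by positivity
  have e (k : ℕ) : 5 ^ n + k * (2 * 5 ^ n) = 5 ^ n * (2 * k + 1) := by ring
  have h2 (m : ℕ) : 2 ∣ 5 ^ n * m ↔ 2 ∣ m :=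
    (Nat.Coprime.pow_right n (by norm_num : Nat.Coprime 2 5)).dvd_mul_left
  simp only [e, Set.mem_insert_iff, Set.mem_singleton_iff]
  constructor
  · rintro ⟨hx, ⟨m, rfl⟩, h5⟩
    rw [pow_succ, mul_dvd_mul_iff_left h0] at h5
    rw [h2] at hx
    exact ⟨m / 2, by omega, by congr 1; omega⟩
  · rintro ⟨k, hk, rfl⟩
    rw [pow_succ, mul_dvd_mul_iff_left h0, h2]
    exact ⟨by omega, dvd_mul_right _ _, by omega⟩

theorem mem_speedSet_even_iff {a s n : ℕ} {e : ℤ} (h2 : 2 ∣ s) (h5 : ¬ 5 ∣ s) (hn : n ≠ 0)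
    (he : e ^ 4 = 1) (hs : e ≡ s [ZMOD 5]) :
    a ∈ speedSet s n ↔ a ≡ s [MOD 10] ∧
      (a : ℤ) ≡ e [ZMOD 5 ^ n] ∧ ¬ (a : ℤ) ≡ e [ZMOD 5 ^ (n + 1)] := by
  rw [mem_speedSet_iff (by omega) hn]
  refine and_congr_right fun ha => ?_
  unfold Nat.ModEq at ha
  have ha5 : (a : ℤ) ≡ s [ZMOD 5] := by unfold Int.ModEq; omega
  have hL := isLift_const he hs
  rw [speedGe_iff_of_even (by omega) (by omega), speedGe_iff_of_even (by omega) (by omega),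
    hL.modEq_five_pow_iff (by omega) ha5, hL.modEq_five_pow_iff (by omega) ha5]

theorem speedSet_six {n : ℕ} (hn : n ≠ 0) : speedSet 6 n =
    {a | ∃ k : ℕ, k % 5 ∈ ({0, 1, 3, 4} : Set ℕ) ∧ a = 5 ^ n + 1 + k * (2 * 5 ^ n)} := by
  ext a
  rw [mem_speedSet_even_iff (s := 6) (e := 1) (by norm_num) (by norm_num) hn (by norm_num)
    (by decide)]
  have e (k : ℕ) : 5 ^ n + 1 + k * (2 * 5 ^ n) = 5 ^ n + k * (2 * 5 ^ n) + 1 := by ring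
  rw [Set.mem_ofPred_eq]
  simp only [e]
  rcases a with - | x
  · simp [Nat.ModEq]
  have hd (m : ℕ) : ((x + 1 : ℕ) : ℤ) ≡ 1 [ZMOD 5 ^ m] ↔ 5 ^ m ∣ x := by
    rw [Int.modEq_comm, Int.modEq_iff_dvd, Nat.cast_add_one, add_sub_cancel_right]
    exact_mod_cast Int.natCast_dvd_natCast
  simp only [Nat.add_right_cancel_iff, hd, ← five_pow_exactly_dvd_odd_iff]
  unfold Nat.ModEq
  constructor
  · rintro ⟨h1, h2⟩
    exact ⟨by omega, h2⟩
  · rintro ⟨h1, h2⟩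
    have := (dvd_pow_self 5 hn).trans h2.1
    exact ⟨by omega, h2⟩

theorem speedSet_four {n : ℕ} (hn : n ≠ 0) : speedSet 4 n =
    {a | ∃ k : ℕ, k % 5 ∈ ({0, 1, 3, 4} : Set ℕ) ∧ a = 5 ^ n - 1 + k * (2 * 5 ^ n)} := by
  ext a
  rw [mem_speedSet_even_iff (s := 4) (e := -1) (by norm_num) (by norm_num) hn (by norm_num)
    (by decide)]
  have h0 : 0 < 5 ^ n := by positivity
  have e (k : ℕ) : a = 5 ^ n - 1 + k * (2 * 5 ^ n) ↔ a + 1 = 5 ^ n + k * (2 * 5 ^ n) := by omega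
  rw [Set.mem_ofPred_eq]
  simp only [e]
  have hd (m : ℕ) : (a : ℤ) ≡ -1 [ZMOD 5 ^ m] ↔ 5 ^ m ∣ a + 1 := by
    rw [Int.modEq_comm, Int.modEq_iff_dvd, sub_neg_eq_add]
    exact_mod_cast Int.natCast_dvd_natCast
  simp only [hd, ← five_pow_exactly_dvd_odd_iff]
  unfold Nat.ModEq
  constructor
  · rintro ⟨h1, h2⟩
    exact ⟨by omega, h2⟩
  · rintro ⟨h1, h2⟩
    have := (dvd_pow_self 5 hn).trans h2.1
    exact ⟨by omega, h2⟩

/-! ### Last digit `5` -/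

/-- The trigonometric expression takes the values `9, 7, 1, 3` periodically; its multiple by `2 ^ n`
is `4` modulo `5`. -/
theorem exists_trig_coefficient (n : ℕ) : ∃ c : ℕ, ¬ 2 ∣ c ∧ c < 10 ∧ 2 ^ n * c % 5 = 4 ∧
    2 * Real.sin (Real.pi * n / 2) + 4 * Real.cos (Real.pi * n / 2) = c - 5 := by
  obtain ⟨q, r, hr, rfl⟩ : ∃ q r, r < 4 ∧ n = r + 4 * q :=
    ⟨n / 4, n % 4, Nat.mod_lt _ (by norm_num), by omega⟩
  have e : Real.pi * ((r + 4 * q : ℕ) : ℝ) / 2 = Real.pi * r / 2 + q * (2 * Real.pi) := by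
    push_cast
    ring
  have h16 (c : ℕ) : 2 ^ (r + 4 * q) * c % 5 = 2 ^ r * c % 5 := by
    rw [pow_add, pow_mul, mul_right_comm, Nat.mul_mod, Nat.pow_mod]
    norm_num
  simp only [e, Real.sin_add_nat_mul_two_pi, Real.cos_add_nat_mul_two_pi, h16]
  have e3 : Real.pi * 3 / 2 = Real.pi / 2 + Real.pi := by ring
  interval_cases r
  · exact ⟨9, by norm_num, by norm_num, by norm_num, by norm_num⟩
  · exact ⟨7, by norm_num, by norm_num, by norm_num, by norm_num⟩
  · exact ⟨1, by norm_num, by norm_num, by norm_num, by norm_num⟩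
  · exact ⟨3, by norm_num, by norm_num, by norm_num, by
      norm_num [e3, Real.sin_add_pi, Real.cos_add_pi]⟩

theorem two_pow_exactly_dvd_iff {x n c r : ℕ} (h2 : ¬ 2 ∣ c) (hc : c < 10)
    (hr : 2 ^ n * c % 5 = r) :
    (2 ^ n ∣ x ∧ ¬ 2 ^ (n + 1) ∣ x ∧ x % 5 = r) ↔ ∃ k : ℕ, x = 2 ^ n * c + k * (10 * 2 ^ n) := by
  have h0 : 2 ^ n ≠ 0 := by positivity
  have e (k : ℕ) : 2 ^ n * c + k * (10 * 2 ^ n) = 2 ^ n * (c + 10 * k) := by ring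
  simp only [e]
  constructor
  · rintro ⟨⟨m, rfl⟩, hm, h5⟩
    rw [pow_succ, mul_dvd_mul_iff_left h0] at hm
    have h : m ≡ c [MOD 5] := Nat.ModEq.cancel_left_of_coprime
      (Nat.Coprime.pow_right n (by norm_num : Nat.Coprime 5 2)) (h5.trans hr.symm)
    unfold Nat.ModEq at h
    exact ⟨m / 10, by congr 1; omega⟩
  · rintro ⟨k, rfl⟩
    rw [pow_succ, mul_dvd_mul_iff_left h0]
    refine ⟨dvd_mul_right _ _, by omega, ?_⟩
    rw [mul_add, mul_left_comm]
    omega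

theorem mem_speedSet_five_iff {a n c : ℕ} (hn : 2 ≤ n) (h2 : ¬ 2 ∣ c) (hc : c < 10)
    (hr : 2 ^ n * c % 5 = 4) :
    a ∈ speedSet 5 n ↔ (∃ k : ℕ, a = 2 ^ n * c + k * (10 * 2 ^ n) + 1) ∨
      ∃ k : ℕ, a + 1 = 2 ^ n * (10 - c) + k * (10 * 2 ^ n) := by
  have hr' : 2 ^ n * (10 - c) % 5 = 1 := by
    have : 2 ^ n * (10 - c) + 2 ^ n * c = 5 * (2 * 2 ^ n) := by
      rw [← mul_add, Nat.sub_add_cancel hc.le]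
      ring
    omega
  have h4 : 4 ∣ 2 ^ n := pow_dvd_pow 2 hn
  rw [mem_speedSet_iff (by norm_num) (by omega), ← two_pow_exactly_dvd_iff (by omega) (by omega) hr']
  rcases a with - | x
  · simp [Nat.ModEq, show n ≠ 0 by omega]
  simp only [Nat.add_right_cancel_iff]
  rw [← two_pow_exactly_dvd_iff h2 hc hr]
  have hd (m : ℕ) : ((x + 1 : ℕ) : ℤ) ≡ 1 [ZMOD 2 ^ m] ↔ 2 ^ m ∣ x := by
    rw [Int.modEq_comm, Int.modEq_iff_dvd, Nat.cast_add_one, add_sub_cancel_right]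
    exact_mod_cast Int.natCast_dvd_natCast
  have hd' (m : ℕ) : ((x + 1 : ℕ) : ℤ) ≡ -1 [ZMOD 2 ^ m] ↔ 2 ^ m ∣ x + 1 + 1 := by
    rw [Int.modEq_comm, Int.modEq_iff_dvd, sub_neg_eq_add]
    exact_mod_cast Int.natCast_dvd_natCast
  have hle (y : ℕ) (h : 2 ^ (n + 1) ∣ y) : 2 ^ n ∣ y := (pow_dvd_pow 2 n.le_succ).trans h
  have h4' (y : ℕ) (h : 2 ^ n ∣ y) : 4 ∣ y := h4.trans h
  by_cases hx : x + 1 ≡ 5 [MOD 10]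
  · have h5 : 5 ∣ x + 1 := by unfold Nat.ModEq at hx; omega
    have hodd : ¬ 2 ∣ x + 1 := by unfold Nat.ModEq at hx; omega
    rw [speedGe_iff_of_odd hodd (by omega), speedGe_iff_of_odd hodd (by omega)]
    simp only [hd, hd', hx, h5, true_or, true_and, show x % 5 = 4 by omega,
      show (x + 1 + 1) % 5 = 1 by omega, and_true]
    have g1 := hle x
    have g2 := hle (x + 1 + 1)
    have g3 : ¬ (2 ^ n ∣ x ∧ 2 ^ n ∣ x + 1 + 1) := by
      rintro ⟨h, h'⟩
      have := h4' _ h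
      have := h4' _ h'
      omega
    tauto
  · refine iff_of_false (fun h => hx h.1) ?_
    unfold Nat.ModEq at hx
    rintro (⟨h, -, h'⟩ | ⟨h, -, h'⟩) <;> have := h4' _ h <;> omega

theorem speedSet_five {n : ℕ} (hn : 2 ≤ n) : speedSet 5 n =
    {a : ℕ | ∃ k : ℕ, (a : ℝ) = 2 ^ n * (5 + 2 * Real.sin (Real.pi * n / 2)
      + 4 * Real.cos (Real.pi * n / 2)) + 1 + k * 5 * 2 ^ (n + 1)} ∪
    {a : ℕ | ∃ k : ℕ, (a : ℝ) = 2 ^ n * (5 - 2 * Real.sin (Real.pi * n / 2)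
      - 4 * Real.cos (Real.pi * n / 2)) - 1 + k * 5 * 2 ^ (n + 1)} := by
  obtain ⟨c, h2, hc, hr, ht⟩ := exists_trig_coefficient n
  ext a
  rw [mem_speedSet_five_iff hn h2 hc hr]
  refine or_congr (exists_congr fun k => ?_) (exists_congr fun k => ?_)
  · rw [add_assoc (5 : ℝ), ht, ← Nat.cast_inj (R := ℝ)]
    push_cast
    constructor <;> intro h <;> rw [h] <;> ring
  · rw [sub_sub (5 : ℝ), ht, ← Nat.cast_inj (R := ℝ)]
    push_cast [hc.le]
    constructor <;> intro h <;> linear_combination h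

theorem exists_isLeast_speedSet_five {n : ℕ} (hn : 2 ≤ n) :
    ∃ m, IsLeast (speedSet 5 n) m ∧ m ≤ 9 * 2 ^ n + 1 := by
  obtain ⟨c, h2, hc, hr, -⟩ := exists_trig_coefficient n
  have hmem : 2 ^ n * c + 1 ∈ speedSet 5 n :=
    (mem_speedSet_five_iff hn h2 hc hr).2 (Or.inl ⟨0, by ring⟩)
  refine ⟨sInf (speedSet 5 n), ⟨Nat.sInf_mem ⟨_, hmem⟩, fun _ h => Nat.sInf_le h⟩,
    (Nat.sInf_le hmem).trans ?_⟩
  have : 2 ^ n * c ≤ 2 ^ n * 9 := Nat.mul_le_mul_left _ (by omega)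
  omega

/-! ### Valuation bounds and bases of speed one -/

theorem five_pow_dvd_sq_sub_one {a n : ℕ} (h : a % 5 = 1 ∨ a % 5 = 4)
    (hd : (5 : ℤ) ^ n ∣ (a : ℤ) ^ 4 - 1) : 5 ^ n ∣ a ^ 2 - 1 := by
  have ha : 1 ≤ a ^ 2 := Nat.one_le_pow _ _ (by omega)
  have h5 : ¬ 5 ∣ a ^ 2 + 1 := by
    rw [Nat.dvd_iff_mod_eq_zero, Nat.add_mod, Nat.pow_mod]
    rcases h with h | h <;> rw [h] <;> norm_num
  rw [← Int.natCast_dvd_natCast]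
  push_cast [ha]
  rw [show (a : ℤ) ^ 4 - 1 = (a ^ 2 - 1) * (a ^ 2 + 1) by ring] at hd
  exact (pow_dvd_left_of_not_dvd Nat.prime_five (by exact_mod_cast h5)).1 hd

theorem five_pow_dvd_sq_add_one {a n : ℕ} (h : a % 5 = 2 ∨ a % 5 = 3)
    (hd : (5 : ℤ) ^ n ∣ (a : ℤ) ^ 4 - 1) : 5 ^ n ∣ a ^ 2 + 1 := by
  have h5 : ¬ (5 : ℤ) ∣ (a : ℤ) ^ 2 - 1 := by
    have h' : (a : ℤ) % 5 = 2 ∨ (a : ℤ) % 5 = 3 := by omega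
    rw [Int.dvd_iff_emod_eq_zero, Int.sub_emod, pow_two, Int.mul_emod]
    rcases h' with h | h <;> rw [h] <;> norm_num
  rw [← Int.natCast_dvd_natCast]
  push_cast
  rw [show (a : ℤ) ^ 4 - 1 = (a ^ 2 + 1) * (a ^ 2 - 1) by ring] at hd
  exact (pow_dvd_left_of_not_dvd Nat.prime_five h5).1 hd

/-- An odd base of positive speed is not `1`, so that `a ^ 2 - 1` has genuine valuations, and its
`2`-adic valuation is at least the speed. -/
theorem le_padicValNat_two {a s n : ℕ} (h2 : ¬ 2 ∣ s) (hs : ¬ 10 ∣ s) (hn : n ≠ 0)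
    (ha : a ∈ speedSet s n) : a ^ 2 - 1 ≠ 0 ∧ n ≤ padicValNat 2 (a ^ 2 - 1) := by
  obtain ⟨hmod, ⟨-, hge⟩, hlt⟩ := (mem_speedSet_iff hs hn).1 ha
  have h2a : ¬ 2 ∣ a := by unfold Nat.ModEq at hmod; omega
  have ha2 : 2 ≤ a := by
    by_contra! h
    obtain rfl : a = 1 := by omega
    exact hlt (by simp [SpeedGe])
  have h := (natCast_pow_dvd_pow_sub_one (p := 2) ha2 two_ne_zero).1 (hge.resolve_left h2a)
  exact ⟨pow_sub_one_ne_zero ha2 two_ne_zero, by omega⟩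

theorem five_pow_dvd_of_mem_speedSet {a s n : ℕ} (h5 : ¬ 5 ∣ s) (hn : n ≠ 0)
    (ha : a ∈ speedSet s n) : a % 5 = s % 5 ∧ (5 : ℤ) ^ n ∣ (a : ℤ) ^ 4 - 1 := by
  obtain ⟨hmod, ⟨hge, -⟩, -⟩ := (mem_speedSet_iff (by omega) hn).1 ha
  unfold Nat.ModEq at hmod
  exact ⟨by omega, hge.resolve_left (by omega)⟩

theorem le_min_of_mem_speedSet_one_nine {a n : ℕ} (hn : n ≠ 0)
    (ha : a ∈ speedSet 1 n ∪ speedSet 9 n) :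
    n ≤ min (padicValNat 5 (a ^ 2 - 1)) (padicValNat 2 (a ^ 2 - 1)) := by
  have key (s : ℕ) (h2 : ¬ 2 ∣ s) (hs : s % 5 = 1 ∨ s % 5 = 4) (ha : a ∈ speedSet s n) :
      n ≤ min (padicValNat 5 (a ^ 2 - 1)) (padicValNat 2 (a ^ 2 - 1)) := by
    obtain ⟨h0, h⟩ := le_padicValNat_two h2 (by omega) hn ha
    obtain ⟨hm, hd⟩ := five_pow_dvd_of_mem_speedSet (by omega) hn ha
    exact le_min ((padicValNat_dvd_iff_le h0).1 (five_pow_dvd_sq_sub_one (by omega) hd)) h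
  exact ha.elim (key 1 (by norm_num) (by norm_num)) (key 9 (by norm_num) (by norm_num))

theorem le_padicValNat_five {a s n : ℕ} (hs : s % 5 = 2 ∨ s % 5 = 3) (hn : n ≠ 0)
    (ha : a ∈ speedSet s n) : n ≤ padicValNat 5 (a ^ 2 + 1) := by
  obtain ⟨hm, hd⟩ := five_pow_dvd_of_mem_speedSet (by omega) hn ha
  exact (padicValNat_dvd_iff_le (by positivity)).1 (five_pow_dvd_sq_add_one (by omega) hd)

theorem le_min_of_mem_speedSet_three_seven {a n : ℕ} (hn : n ≠ 0)
    (ha : a ∈ speedSet 3 n ∪ speedSet 7 n) :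
    n ≤ min (padicValNat 5 (a ^ 2 + 1)) (padicValNat 2 (a ^ 2 - 1)) := by
  rcases ha with ha | ha <;>
    exact le_min (le_padicValNat_five (by norm_num) hn ha)
      (le_padicValNat_two (by norm_num) (by norm_num) hn ha).2

theorem exists_factorization_sq_add_one (a : ℕ) : ∃ c : ℕ,
    a ^ 2 + 1 = 5 ^ padicValNat 5 (a ^ 2 + 1) * c ∧
    (a : ℝ) = √((5 : ℝ) ^ padicValNat 5 (a ^ 2 + 1) * c - 1) ∧
    (padicValNat 5 (a ^ 2 + 1) : ℝ) = Real.log (((a : ℝ) ^ 2 + 1) / c) / Real.log 5 := by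
  obtain ⟨c, hc⟩ : 5 ^ padicValNat 5 (a ^ 2 + 1) ∣ a ^ 2 + 1 := pow_padicValNat_dvd
  have hr : (a : ℝ) ^ 2 + 1 = 5 ^ padicValNat 5 (a ^ 2 + 1) * c := by exact_mod_cast hc
  have hc0 : (c : ℝ) ≠ 0 := by
    rintro h
    rw [h, mul_zero] at hr
    exact (by positivity : (a : ℝ) ^ 2 + 1 ≠ 0) hr
  refine ⟨c, hc, ?_, ?_⟩
  · rw [← hr, add_sub_cancel_right, Real.sqrt_sq (Nat.cast_nonneg a)]
  · rw [hr, mul_div_cancel_right₀ _ hc0, Real.log_pow,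
      mul_div_cancel_right₀ _ (Real.log_pos (by norm_num)).ne']

theorem hasSpeed_one_iff (a : ℕ) : HasSpeed a 1 ↔
    a % 25 ∈ ({2, 3, 4, 6, 8, 9, 11, 12, 13, 14, 16, 17, 19, 21, 22, 23} : Set ℕ) := by
  simp only [Set.mem_insert_iff, Set.mem_singleton_iff]
  by_cases h10 : 10 ∣ a
  · exact iff_of_false (fun h => h.1 h10) (by omega)
  rw [hasSpeed_iff h10 one_ne_zero]
  -- for odd `a` the `2`-adic condition holds up to speed `2`, as `8 ∣ a ^ 2 - 1`
  have h2 : 2 ∣ a ∨ (2 : ℤ) ^ (2 + 1) ∣ (a : ℤ) ^ 2 - 1 := by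
    refine or_iff_not_imp_left.2 fun h => ?_
    have ho : Odd (a : ℤ) := Int.odd_iff.2 (by omega)
    simpa using Int.eight_dvd_sq_sub_one_of_odd ho
  have h2' : 2 ∣ a ∨ (2 : ℤ) ^ (1 + 1) ∣ (a : ℤ) ^ 2 - 1 :=
    h2.imp_right (pow_dvd_pow 2 (by norm_num)).trans
  rw [SpeedGe, SpeedGe, and_iff_left h2', and_iff_left h2]
  have key (m : ℕ) : (m : ℤ) ∣ (a : ℤ) ^ 4 - 1 ↔ a ^ 4 % m = 1 % m := by
    rw [← Int.modEq_iff_dvd, Int.modEq_comm]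
    exact_mod_cast Int.natCast_modEq_iff (a := a ^ 4) (b := 1)
  have k5 := key 5
  have k25 := key 25
  push_cast at k5 k25
  norm_num only [pow_one, Nat.reduceAdd]
  rw [k5, k25, Nat.pow_mod a 4 25, Nat.pow_mod a 4 5, show a % 5 = a % 25 % 5 by omega,
    show 5 ∣ a ↔ 5 ∣ a % 25 by omega]
  have hlt : a % 25 < 25 := Nat.mod_lt _ (by norm_num)
  generalize a % 25 = r at hlt
  revert r
  decide

theorem mainTheorem2 :
    -- every base that is not a multiple of ten has exactly one constant congruence speed
    (∀ a : ℕ, ¬ 10 ∣ a → ∃! n : ℕ, HasSpeed a n) ∧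
    -- the sequences below consist of residues of decadic roots of y ^ 5 = y
    (IsRootSequence root1 ∧ IsRootSequence root2 ∧ IsRootSequence root3 ∧
      IsRootSequence root3' ∧ IsRootSequence root7 ∧ IsRootSequence root7' ∧
      IsRootSequence root8 ∧ IsRootSequence root9) ∧
    -- the description of all bases of speed at least two
    (∀ n : ℕ, 2 ≤ n →
      speedSet 1 n = rootClass root1 n ∪
        {a | ∃ k : ℕ, k % 10 ∈ ({0, 1, 2, 3, 4, 5, 6, 7, 8} : Set ℕ) ∧
          a = 10 ^ n + 1 + k * 10 ^ n} ∧
      speedSet 9 n = rootClass root9 n ∪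
        {a | ∃ k : ℕ, k % 10 ∈ ({0, 1, 2, 3, 4, 5, 6, 7, 8} : Set ℕ) ∧
          a = 10 ^ n - 1 + k * 10 ^ n} ∧
      speedSet 5 n =
        {a : ℕ | ∃ k : ℕ, (a : ℝ) = 2 ^ n * (5 + 2 * Real.sin (Real.pi * n / 2)
          + 4 * Real.cos (Real.pi * n / 2)) + 1 + k * 5 * 2 ^ (n + 1)} ∪
        {a : ℕ | ∃ k : ℕ, (a : ℝ) = 2 ^ n * (5 - 2 * Real.sin (Real.pi * n / 2)
          - 4 * Real.cos (Real.pi * n / 2)) - 1 + k * 5 * 2 ^ (n + 1)} ∧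
      (∃ m, IsLeast (speedSet 5 n) m ∧ m ≤ 9 * 2 ^ n + 1) ∧
      speedSet 4 n =
        {a | ∃ k : ℕ, k % 5 ∈ ({0, 1, 3, 4} : Set ℕ) ∧ a = 5 ^ n - 1 + k * (2 * 5 ^ n)} ∧
      speedSet 6 n =
        {a | ∃ k : ℕ, k % 5 ∈ ({0, 1, 3, 4} : Set ℕ) ∧ a = 5 ^ n + 1 + k * (2 * 5 ^ n)} ∧
      speedSet 3 n = rootClass root3 n ∪ rootClass root3' n ∧
      speedSet 7 n = rootClass root7 n ∪ rootClass root7' n ∧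
      speedSet 2 n = evenRootClass root2 n ∧
      IsLeast ((fun a : ℕ => (a : ℤ)) '' speedSet 2 n) (leastBase root2 n) ∧
      speedSet 8 n = evenRootClass root8 n ∧
      IsLeast ((fun a : ℕ => (a : ℤ)) '' speedSet 8 n) (leastBase root8 n)) ∧
    -- bounds on the speed in terms of five-adic and two-adic valuations
    (∀ n a : ℕ, 1 ≤ n →
      (a ∈ speedSet 1 n ∪ speedSet 9 n →
        n ≤ min (padicValNat 5 (a ^ 2 - 1)) (padicValNat 2 (a ^ 2 - 1))) ∧
      (a ∈ speedSet 3 n ∪ speedSet 7 n →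
        n ≤ min (padicValNat 5 (a ^ 2 + 1)) (padicValNat 2 (a ^ 2 - 1))) ∧
      (a ∈ speedSet 2 n ∪ speedSet 8 n → ∃ N c : ℕ, N = padicValNat 5 (a ^ 2 + 1) ∧
        a ^ 2 + 1 = 5 ^ N * c ∧ n ≤ N ∧
        (a : ℝ) = √((5 : ℝ) ^ N * c - 1) ∧
        (N : ℝ) = Real.log (((a : ℝ) ^ 2 + 1) / c) / Real.log 5)) ∧
    -- the bases of speed one
    {a | HasSpeed a 1} =
      {a | a % 25 ∈ ({2, 3, 4, 6, 8, 9, 11, 12, 13, 14, 16, 17, 19, 21, 22, 23} : Set ℕ)} := by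
  refine ⟨fun a => existsUnique_hasSpeed, ?_, fun n hn => ?_, fun n a hn => ?_, ?_⟩
  · exact ⟨isLift_root1.isRootSequence (by norm_num) (by norm_num),
      isLift_root2.isRootSequence (by norm_num) (by norm_num),
      isLift_root3.isRootSequence (by norm_num) (by norm_num),
      isLift_root3'.isRootSequence (by norm_num) (by norm_num),
      isLift_root7.isRootSequence (by norm_num) (by norm_num),
      isLift_root7'.isRootSequence (by norm_num) (by norm_num),
      isLift_root8.isRootSequence (by norm_num) (by norm_num),
      isLift_root9.isRootSequence (by norm_num) (by norm_num)⟩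
  · have hn0 : n ≠ 0 := by omega
    have e2 : speedSet 2 n = evenRootClass root2 n :=
      speedSet_eq_evenRootClass (by norm_num) (by norm_num) hn0 isLift_root2
    have e8 : speedSet 8 n = evenRootClass root8 n :=
      speedSet_eq_evenRootClass (by norm_num) (by norm_num) hn0 isLift_root8
    refine ⟨?_, ?_, speedSet_five hn, exists_isLeast_speedSet_five hn, speedSet_four hn0,
      speedSet_six hn0, speedSet_eq_union (by norm_num) (by norm_num) hn isLift_root3 isLift_root3',
      ?_, e2, ?_, e8, ?_⟩
    · rw [← rootClass_one hn0, Set.union_comm]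
      exact speedSet_eq_union (by norm_num) (by norm_num) hn (isLift_const (by norm_num) rfl)
        isLift_root1
    · rw [← rootClass_neg_one n]
      exact speedSet_eq_union (by norm_num) (by norm_num) hn isLift_root9
        (isLift_const (by norm_num) rfl)
    · rw [Set.union_comm]
      exact speedSet_eq_union (by norm_num) (by norm_num) hn isLift_root7' isLift_root7
    · rw [e2]
      exact isLeast_evenRootClass hn0
        (isLift_root2.succ_modEq_of_even (s := 2) (by norm_num) hn0)
    · rw [e8]
      exact isLeast_evenRootClass hn0
        (isLift_root8.succ_modEq_of_even (s := 8) (by norm_num) hn0)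
  · have hn0 : n ≠ 0 := by omega
    refine ⟨le_min_of_mem_speedSet_one_nine hn0, le_min_of_mem_speedSet_three_seven hn0,
      fun ha => ?_⟩
    obtain ⟨c, h1, h2, h3⟩ := exists_factorization_sq_add_one a
    exact ⟨_, c, rfl, h1, ha.elim (le_padicValNat_five (by norm_num) hn0)
      (le_padicValNat_five (by norm_num) hn0), h2, h3⟩
  · exact Set.ext hasSpeed_one_iff
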